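/- Let $n\ge 1$. Let $\mathrm{Tree}(n+1)$ be the set of trees with vertex set $\{0,1,\dots,n\}$, rooted at $0$. For $T\in\mathrm{Tree}(n+1)$, let $\mathrm{inv}(T)$ be the number of pairs $(i,j)$ with $1\le i<j\le n$ such that $j$ lies on the path from $i$ to the root, let $\mathrm{lev}(T)$ be the number of leaves of $T$ (vertices without children), and set $$I_n(q,t)=\sum_{T\in\mathrm{Tree}(n+1)}q^{\mathrm{inv}(T)}\,t^{\mathrm{lev}(T)-1}.$$ For a permutation $w\in\mathfrak S_m$, let $\mathrm{des}(w)$ be the number of indices $i\in\{1,\dots,m-1\}$ with $w(i)>w(i+1)$. Call $w$ simsun if for every $j$, the word obtained from $w(1)w(2)\cdots w(m)$ by deleting all entries greater than $j$ has no three consecutive entries $a,b,c$ with $a>b>c$. Let $\mathrm{Simsun}(m)$ be the set of simsun permutations in $\mathfrak S_m$; in particular, $\mathrm{Simsun}(0)$ consists of the empty permutation, which has no descents. Then $$I_n(-1,t)=\sum_{w\in\mathrm{Simsun}(n-1)}t^{\,n-1-\mathrm{des}(w)}.$$ The identity holds as polynomials in $t$ with integer coefficients; equivalently, it holds for every element $t$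 of every commutative ring. -/

import Mathlib

/-- `j` lies on the path from `i` to the root `0`, in a graph on the vertices `0, …, n`
(in a tree this path is unique). -/
def OnRootPath {n : ℕ} (T : SimpleGraph (Fin (n + 1))) (j i : Fin (n + 1)) : Prop :=
  ∃ p : T.Walk i 0, p.IsPath ∧ j ∈ p.support

/-- In a tree rooted at `0`, the vertex `w` is a child of `v`. -/
def IsChild {n : ℕ} (T : SimpleGraph (Fin (n + 1))) (w v : Fin (n + 1)) : Prop :=
  T.Adj v w ∧ OnRootPath T v w

open Classical in
/-- The number of inversions: pairs `1 ≤ i < j ≤ n` such that `j` lies on the path from `i`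
to the root. -/
noncomputable def treeInv {n : ℕ} (T : SimpleGraph (Fin (n + 1))) : ℕ :=
  (Finset.univ.filter fun p : Fin (n + 1) × Fin (n + 1) =>
    0 < p.1 ∧ p.1 < p.2 ∧ OnRootPath T p.2 p.1).card

open Classical in
/-- The number of leaves of a tree rooted at `0`: a leaf is a vertex without children
(so the root is not a leaf as soon as `n ≥ 1`, even if it has degree one). -/
noncomputable def treeLev {n : ℕ} (T : SimpleGraph (Fin (n + 1))) : ℕ :=
  (Finset.univ.filter fun v : Fin (n + 1) => ∀ w, ¬ IsChild T w v).card

open Classical in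
/-- `Tree(n+1)`: the trees with vertex set `{0, 1, …, n}`, rooted at `0`. -/
noncomputable def rootedTrees (n : ℕ) : Finset (SimpleGraph (Fin (n + 1))) :=
  Finset.univ.filter fun T => T.IsTree

/-- The enumerator `I_n(q,t) = ∑_T q^{inv T} t^{lev T - 1}`, evaluated at elements `q`, `t` of a
commutative ring. A tree has at least one leaf, so the exponent of `t` is not truncated. -/
noncomputable def treeEnumerator {R : Type*} [CommRing R] (n : ℕ) (q t : R) : R :=
  ∑ T ∈ rootedTrees n, q ^ treeInv T * t ^ (treeLev T - 1)

/-- The word `u` has a double descent: three consecutive decreasing entries. -/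
def HasDoubleDescent (u : List ℕ) : Prop :=
  ∃ (i : ℕ) (h : i + 2 < u.length), u[i] > u[i + 1] ∧ u[i + 1] > u[i + 2]

/-- The one-line word `w(1) ⋯ w(m)` of a permutation, with entries in `{1, …, m}`. -/
def permWord {m : ℕ} (w : Equiv.Perm (Fin m)) : List ℕ :=
  List.ofFn fun i => (w i : ℕ) + 1

/-- `w` is simsun: for every `j`, deleting from the word of `w` all entries greater than `j`
leaves a word without double descents. -/
def IsSimsun {m : ℕ} (w : Equiv.Perm (Fin m)) : Prop :=
  ∀ j : ℕ, ¬ HasDoubleDescent ((permWord w).filter fun a => a ≤ j)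

/-- The number of descents of a permutation. -/
def permDes {m : ℕ} (w : Equiv.Perm (Fin m)) : ℕ :=
  (Finset.univ.filter fun i : Fin m =>
    ∃ h : (i : ℕ) + 1 < m, w i > w ⟨(i : ℕ) + 1, h⟩).card

open Classical in
/-- The set of simsun permutations in the symmetric group on `m` letters. -/
noncomputable def simsunPerms (m : ℕ) : Finset (Equiv.Perm (Fin m)) :=
  Finset.univ.filter fun w => IsSimsun w

/-! ### Simsun permutations: insertion of the largest letter -/

/-! Multiplied by t, both sides are terms of one sequence with g_0 = 1.

Deleting the root 0 turns a tree into a rooted forest with the same inversions, and the factor t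
restores the full leaf count (`mul_treeEnumerator`). Split off the component containing a marked
vertex. At q = -1 the choices of its root carry alternating signs, according to the rank of the root
in the component, and they cancel unless the component has odd size. Hence (`forestSum_neg_one`)
g_{n+1} = (t-1) g_n + sum over even k of binom(n,k) g_k g_{n-k}; the first term appears because an
isolated vertex is itself a leaf.

For simsun permutations, inserting the largest letter gives a recurrence involving the derivative in
t (`simsunPoly_succ`). It implies the same convolution (`convolution_of_derivative_recurrence`):
with a = t-1, the exponential generating function F satisfies (1-ax)F_x = 1 + aF + (1-a^2)F_t. This
forces the Riccati equation 2F_x = 2aF + F^2 + 1 (`riccati_of_linear_pde`), which gives F(x)F(-x) =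
1 (`mul_rescale_neg_eq_one`). Replacing the constant 1 by this product leaves F_x = aF + F_even F,
which is the convolution.

The generating functions need rational coefficients; the identity then descends to ℤ[t] and
specializes to every commutative ring. -/

/-- The word `u` begins with a descent. -/
def StartsWithDescent : List ℕ → Prop
  | y :: z :: _ => z < y
  | _ => False

open Classical in
/-- The number of letters of a word that are not followed by a smaller letter. -/
noncomputable def nonDescents : List ℕ → ℕ
  | [] => 0
  | y :: l => nonDescents l + if StartsWithDescent (y :: l) then 0 else 1

theorem hasDoubleDescent_cons (y : ℕ) (l : List ℕ) :
    HasDoubleDescent (y :: l) ↔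
      (StartsWithDescent (y :: l) ∧ StartsWithDescent l) ∨ HasDoubleDescent l := by
  constructor
  · rintro ⟨i, h, h1, h2⟩
    cases i with
    | zero =>
      left
      match l, h, h1, h2 with
      | z :: w :: r, h, h1, h2 =>
        simp only [List.getElem_cons_zero, List.getElem_cons_succ] at h1 h2
        exact ⟨h1, h2⟩
    | succ i =>
      right
      refine ⟨i, by simp only [List.length_cons] at h; omega, ?_, ?_⟩
      · simpa using h1
      · simpa using h2
  · rintro (⟨h1, h2⟩ | ⟨i, h, h1, h2⟩)
    · match l, h1, h2 with
      | z :: w :: r, h1, h2 =>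
        exact ⟨0, by simp, h1, h2⟩
    · exact ⟨i + 1, by simp only [List.length_cons]; omega, by simpa using h1, by simpa using h2⟩

theorem not_hasDoubleDescent_nil : ¬ HasDoubleDescent [] := by
  rintro ⟨i, h, -⟩
  simp at h

open Classical in
/-- The weight of a word: zero if it has a double descent, else a power of `x`. -/
noncomputable def descentWeight {R : Type*} [CommRing R] (x : R) (l : List ℕ) : R :=
  if HasDoubleDescent l then 0 else x ^ nonDescents l

/-- After an insertion, the letter following z is either the larger letter M or the letter that
followed z before. -/
theorem not_startsWithDescent_of_mem_permutations'Aux {M z : ℕ} {zs l : List ℕ} (hz : z < M)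
    (h : ¬ StartsWithDescent (z :: zs)) (hl : l ∈ List.permutations'Aux M zs) :
    ¬ StartsWithDescent (z :: l) := by
  cases zs with
  | nil =>
    simp only [List.permutations'Aux, List.mem_singleton] at hl
    subst hl
    simpa [StartsWithDescent] using hz.le
  | cons a as =>
    simp only [List.permutations'Aux, List.mem_cons, List.mem_map] at hl
    rcases hl with rfl | ⟨l, -, rfl⟩
    · simpa [StartsWithDescent] using hz.le
    · exact h

-- At the end or inside a descent, M adds one non-descent. In any other gap the number is unchanged,
-- but a double descent arises if the next letter begins a descent. The front gap is left out so
-- that induction can peel off the head; the indicator corrects for it.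
open Classical in
theorem sum_descentWeight_insert_after_head {R : Type*} [CommRing R] (x : R) (M : ℕ)
    (zs : List ℕ) : ∀ z : ℕ, ¬ HasDoubleDescent (z :: zs) → (∀ a ∈ z :: zs, a < M) →
    ((List.permutations'Aux M zs).map fun l => descentWeight x (z :: l)).sum =
      (((z :: zs).length : R) + 1 - nonDescents (z :: zs)) * x ^ (nonDescents (z :: zs) + 1) +
      (2 * (nonDescents (z :: zs) : R) - ((z :: zs).length : R) - 1 +
        if StartsWithDescent (z :: zs) then 1 else 0) * x ^ nonDescents (z :: zs) := by
  induction zs with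
  | nil =>
    intro z hz hM
    have : z < M := hM z (by simp)
    have hd : ¬ HasDoubleDescent [z, M] := by
      simp [hasDoubleDescent_cons, StartsWithDescent, not_hasDoubleDescent_nil]
    simp [List.permutations'Aux, descentWeight, hd, nonDescents, StartsWithDescent, not_lt.2 this.le]
    ring
  | cons z zs ih =>
    intro y hy hM
    have hzM : z < M := hM z (by simp)
    have hyM : y < M := hM y (by simp)
    have hdd := hy
    rw [hasDoubleDescent_cons] at hy
    push Not at hy
    obtain ⟨hy1, hy2⟩ := hy
    have ih := ih z hy2 (fun a ha => hM a (by simp at ha ⊢; tauto))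
    have e1 : ((List.permutations'Aux M (z :: zs)).map fun l => descentWeight x (y :: l)).sum =
        descentWeight x (y :: M :: z :: zs) +
        ((List.permutations'Aux M zs).map fun l => descentWeight x (y :: z :: l)).sum := by
      simp [List.permutations'Aux, Function.comp_def]
    rw [e1]
    have hyMs : ¬ StartsWithDescent (y :: M :: z :: zs) := by
      simpa [StartsWithDescent] using hyM.le
    have hMs : StartsWithDescent (M :: z :: zs) := hzM
    have e2 : descentWeight x (y :: M :: z :: zs) =
        if StartsWithDescent (z :: zs) then 0 else x ^ (nonDescents (z :: zs) + 1) := by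
      have h1 : HasDoubleDescent (y :: M :: z :: zs) ↔ StartsWithDescent (z :: zs) := by
        rw [hasDoubleDescent_cons, hasDoubleDescent_cons M]
        tauto
      have h2 : nonDescents (y :: M :: z :: zs) = nonDescents (z :: zs) + 1 := by
        rw [nonDescents, nonDescents, if_neg hyMs, if_pos hMs]
      rw [descentWeight, h2]
      simp only [h1]
    -- If y > z, then z begins no descent, before or after an insertion to its right, so prefixing y
    -- changes neither factor of the weight. Otherwise y contributes a factor x.
    by_cases hyz : StartsWithDescent (y :: z :: zs)
    · have hz := hy1 hyz
      have e3 : (List.permutations'Aux M zs).map (fun l => descentWeight x (y :: z :: l)) =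
          (List.permutations'Aux M zs).map (fun l => descentWeight x (z :: l)) := by
        apply List.map_congr_left
        intro l hl
        have h1 := not_startsWithDescent_of_mem_permutations'Aux hzM hz hl
        have h3 : StartsWithDescent (y :: z :: l) := hyz
        have h2 : HasDoubleDescent (y :: z :: l) ↔ HasDoubleDescent (z :: l) := by
          rw [hasDoubleDescent_cons]; tauto
        have h4 : nonDescents (y :: z :: l) = nonDescents (z :: l) := by
          rw [nonDescents, if_pos h3, add_zero]
        rw [descentWeight, descentWeight, h4]
        simp only [h2]
      have e4 : nonDescents (y :: z :: zs) = nonDescents (z :: zs) := by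
        rw [nonDescents, if_pos hyz, add_zero]
      rw [e3, ih, e2, e4, if_neg hz, if_pos hyz]
      simp only [hz, if_false, List.length_cons]
      push_cast
      ring
    · have e3 : (List.permutations'Aux M zs).map (fun l => descentWeight x (y :: z :: l)) =
          (List.permutations'Aux M zs).map (fun l => x * descentWeight x (z :: l)) := by
        apply List.map_congr_left
        intro l hl
        have h3 : ¬ StartsWithDescent (y :: z :: l) := hyz
        have h2 : HasDoubleDescent (y :: z :: l) ↔ HasDoubleDescent (z :: l) := by
          rw [hasDoubleDescent_cons]; tauto
        have h4 : nonDescents (y :: z :: l) = nonDescents (z :: l) + 1 := by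
          rw [nonDescents, if_neg h3]
        rw [descentWeight, descentWeight, h4]
        simp only [h2]
        split_ifs <;> ring
      have e4 : nonDescents (y :: z :: zs) = nonDescents (z :: zs) + 1 := by
        rw [nonDescents, if_neg hyz]
      rw [e3, List.sum_map_mul_left, ih, e2, e4, if_neg hyz]
      simp only [List.length_cons]
      push_cast
      split_ifs <;> ring

/-- With length m and k non-descents, the end and the m-k descents are the gaps that gain a
non-descent. Of the other k gaps, each descent spoils the one before its top, leaving 2k-m. The
front gap absorbs the indicator of `sum_descentWeight_insert_after_head`. -/
theorem sum_descentWeight_permutations'Aux {R : Type*} [CommRing R] (x : R) (M : ℕ)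
    (l : List ℕ) (hl : ¬ HasDoubleDescent l) (hM : ∀ a ∈ l, a < M) :
    ((List.permutations'Aux M l).map (descentWeight x)).sum =
      ((l.length : R) + 1 - nonDescents l) * x ^ (nonDescents l + 1) +
      (2 * (nonDescents l : R) - l.length) * x ^ nonDescents l := by
  classical
  cases l with
  | nil =>
    have : ¬ HasDoubleDescent [M] := by
      simp [hasDoubleDescent_cons, StartsWithDescent, not_hasDoubleDescent_nil]
    simp [List.permutations'Aux, descentWeight, this, nonDescents, StartsWithDescent]
  | cons z zs =>
    have h0 := sum_descentWeight_insert_after_head x M zs z hl hM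
    have hMs : StartsWithDescent (M :: z :: zs) := hM z (by simp)
    have h1 : HasDoubleDescent (M :: z :: zs) ↔ StartsWithDescent (z :: zs) := by
      rw [hasDoubleDescent_cons]
      tauto
    have h2 : nonDescents (M :: z :: zs) = nonDescents (z :: zs) := by
      rw [nonDescents, if_pos hMs, add_zero]
    have e : ((List.permutations'Aux M (z :: zs)).map (descentWeight x)).sum =
        descentWeight x (M :: z :: zs) +
        ((List.permutations'Aux M zs).map fun l => descentWeight x (z :: l)).sum := by
      simp [List.permutations'Aux, Function.comp_def]
    rw [e, h0, descentWeight, h2]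
    simp only [h1]
    split_ifs <;> ring

/-! ### Simsun words and the passage from permutations to words -/

/-- The simsun condition for words. -/
def IsSimsunWord (l : List ℕ) : Prop :=
  ∀ j : ℕ, ¬ HasDoubleDescent (l.filter fun a => a ≤ j)

theorem filter_eq_of_mem_permutations'Aux {M : ℕ} (p : ℕ → Bool) (hp : p M = false)
    (l : List ℕ) : ∀ l' ∈ List.permutations'Aux M l, l'.filter p = l.filter p := by
  induction l with
  | nil => simp [List.permutations'Aux, hp]
  | cons y ys ih =>
    intro l' hl'
    simp only [List.permutations'Aux, List.mem_cons, List.mem_map] at hl'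
    rcases hl' with rfl | ⟨l'', h, rfl⟩
    · simp [hp]
    · rw [List.filter_cons, List.filter_cons, ih l'' h]

theorem perm_of_mem_permutations'Aux {M : ℕ} {l : List ℕ} :
    ∀ l' ∈ List.permutations'Aux M l, l'.Perm (M :: l) := by
  induction l with
  | nil => simp [List.permutations'Aux]
  | cons y ys ih =>
    intro l' hl'
    simp only [List.permutations'Aux, List.mem_cons, List.mem_map] at hl'
    rcases hl' with rfl | ⟨l'', h, rfl⟩
    · rfl
    · exact ((ih l'' h).cons y).trans (List.Perm.swap _ _ _)

/-- Truncation at j ≤ m removes the inserted letter, so it acts alike on both words; truncation at j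
> m removes nothing. -/
theorem isSimsunWord_of_mem_permutations'Aux {m : ℕ} {l l' : List ℕ} (hl : ∀ a ∈ l, a ≤ m)
    (h : l' ∈ List.permutations'Aux (m + 1) l) :
    IsSimsunWord l' ↔ IsSimsunWord l ∧ ¬ HasDoubleDescent l' := by
  have h1 : ∀ j ≤ m, l'.filter (fun a => a ≤ j) = l.filter fun a => a ≤ j := fun j hj =>
    filter_eq_of_mem_permutations'Aux _ (by simpa using hj) l l' h
  have h2 : ∀ j, m < j → l'.filter (fun a => a ≤ j) = l' := fun j hj => by
    rw [List.filter_eq_self]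
    intro a ha
    have := (perm_of_mem_permutations'Aux l' h).mem_iff.1 ha
    rcases List.mem_cons.1 this with rfl | h'
    · simpa using hj
    · simpa using (hl a h').trans hj.le
  have h3 : ∀ j, m ≤ j → l.filter (fun a => a ≤ j) = l := fun j hj => by
    rw [List.filter_eq_self]
    intro a ha
    simpa using (hl a ha).trans hj
  constructor
  · intro H
    have H1 : ∀ j ≤ m, ¬ HasDoubleDescent (l.filter fun a => a ≤ j) := fun j hj => by
      rw [← h1 j hj]; exact H j
    refine ⟨fun j => ?_, ?_⟩
    · rcases le_or_gt j m with hj | hj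
      · exact H1 j hj
      · rw [h3 j hj.le, ← h3 m le_rfl]; exact H1 m le_rfl
    · rw [← h2 (m + 1) (Nat.lt_succ_self m)]; exact H _
  · rintro ⟨H1, H2⟩ j
    rcases le_or_gt j m with hj | hj
    · rw [h1 j hj]; exact H1 j
    · rw [h2 j hj]; exact H2

theorem IsSimsunWord.not_hasDoubleDescent {l : List ℕ} (h : IsSimsunWord l) {m : ℕ}
    (hl : ∀ a ∈ l, a ≤ m) : ¬ HasDoubleDescent l := by
  have := h m
  rwa [List.filter_eq_self.2 (by simpa using hl)] at this

/-- The word `m, m - 1, …, 1`. -/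
def descendingWord : ℕ → List ℕ
  | 0 => []
  | m + 1 => (m + 1) :: descendingWord m

theorem mem_descendingWord {m a : ℕ} : a ∈ descendingWord m ↔ 1 ≤ a ∧ a ≤ m := by
  induction m with
  | zero => simp [descendingWord]; omega
  | succ m ih => simp [descendingWord, ih]; omega

theorem length_descendingWord (m : ℕ) : (descendingWord m).length = m := by
  induction m with
  | zero => rfl
  | succ m ih => simp [descendingWord, ih]

theorem nodup_descendingWord (m : ℕ) : (descendingWord m).Nodup := by
  induction m with
  | zero => simp [descendingWord]
  | succ m ih => simp [descendingWord, ih, mem_descendingWord]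

theorem permWord_perm_descendingWord {m : ℕ} (w : Equiv.Perm (Fin m)) :
    (permWord w).Perm (descendingWord m) := by
  have h1 : (permWord w).Perm (List.ofFn fun i : Fin m => (i : ℕ) + 1) :=
    Equiv.Perm.ofFn_comp_perm w fun i : Fin m => (i : ℕ) + 1
  refine h1.trans ?_
  rw [List.perm_ext_iff_of_nodup _ (nodup_descendingWord m)]
  · intro a
    rw [mem_descendingWord, List.mem_ofFn]
    constructor
    · rintro ⟨i, rfl⟩
      exact ⟨by omega, by omega⟩
    · rintro ⟨h1, h2⟩
      exact ⟨⟨a - 1, by omega⟩, by simp only; omega⟩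
  · rw [List.nodup_ofFn]
    intro i j h
    have h' : (i : ℕ) + 1 = (j : ℕ) + 1 := h
    ext
    omega

theorem permWord_injective (m : ℕ) : Function.Injective (permWord (m := m)) := by
  intro w w' h
  have := List.ofFn_injective h
  ext i
  have := congrFun this i
  simpa using this

/-- The words of permutations are distinct members of the list, and both sides count m!. The
descending base word makes `List.permutations'` insert the largest letter last. -/
theorem sum_permWord {M : Type*} [AddCommMonoid M] (m : ℕ) (G : List ℕ → M) :
    ∑ w : Equiv.Perm (Fin m), G (permWord w) =
      ((List.permutations' (descendingWord m)).map G).sum := by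
  classical
  have hnd : (List.permutations' (descendingWord m)).Nodup :=
    (List.permutations_perm_permutations' _).nodup_iff.1
      (List.nodup_permutations _ (nodup_descendingWord m))
  have hlen : (List.permutations' (descendingWord m)).length = m.factorial := by
    rw [← (List.permutations_perm_permutations' _).length_eq, List.length_permutations,
      length_descendingWord]
  have him : Finset.univ.image (permWord (m := m)) =
      (List.permutations' (descendingWord m)).toFinset := by
    apply Finset.eq_of_subset_of_card_le
    · intro l hl
      obtain ⟨w, -, rfl⟩ := Finset.mem_image.1 hl
      rw [List.mem_toFinset, List.mem_permutations']
      exact permWord_perm_descendingWord w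
    · rw [List.toFinset_card_of_nodup hnd, hlen,
        Finset.card_image_of_injective _ (permWord_injective m), Finset.card_univ,
        Fintype.card_perm, Fintype.card_fin]
  rw [← List.sum_toFinset _ hnd, ← him, Finset.sum_image]
  exact fun a _ b _ h => permWord_injective m h

/-- The last letter counts as a non-descent, so the total is m and not m - 1. -/
theorem nonDescents_ofFn_add (m : ℕ) : ∀ f : Fin m → ℕ,
    nonDescents (List.ofFn f) +
      (Finset.univ.filter fun i : Fin m => ∃ h : (i : ℕ) + 1 < m, f ⟨(i : ℕ) + 1, h⟩ < f i).card
      = m := by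
  induction m with
  | zero => intro f; simp [nonDescents]
  | succ m ih =>
    intro f
    have hs := ih fun i => f i.succ
    rw [List.ofFn_succ, nonDescents, Fin.card_filter_univ_succ]
    have h1 : (Finset.univ.filter fun i : Fin m =>
        ∃ h : (i.succ : ℕ) + 1 < m + 1, f ⟨(i.succ : ℕ) + 1, h⟩ < f i.succ) =
        Finset.univ.filter fun i : Fin m =>
          ∃ h : (i : ℕ) + 1 < m, f (Fin.succ ⟨(i : ℕ) + 1, h⟩) < f i.succ := by
      ext i
      simp [Fin.succ]
    have h2 : StartsWithDescent (f 0 :: List.ofFn fun i => f i.succ) ↔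
        ∃ h : ((0 : Fin (m + 1)) : ℕ) + 1 < m + 1,
          f ⟨((0 : Fin (m + 1)) : ℕ) + 1, h⟩ < f 0 := by
      cases m with
      | zero => exact iff_of_false (by simp [StartsWithDescent]) fun ⟨h, _⟩ => absurd h (by simp)
      | succ m =>
        rw [List.ofFn_succ]
        exact ⟨fun h => ⟨by simp, h⟩, fun ⟨_, h⟩ => h⟩
    simp only [h1, h2]
    split_ifs <;> omega

theorem nonDescents_permWord {m : ℕ} (w : Equiv.Perm (Fin m)) :
    m - permDes w = nonDescents (permWord w) := by
  have h := nonDescents_ofFn_add m fun i => (w i : ℕ) + 1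
  have : permDes w = (Finset.univ.filter fun i : Fin m =>
      ∃ h : (i : ℕ) + 1 < m, (w ⟨(i : ℕ) + 1, h⟩ : ℕ) + 1 < (w i : ℕ) + 1).card := by
    unfold permDes
    congr 1
    ext i
    simp
  rw [← this] at h
  unfold permWord
  omega

/-- The enumerator of simsun permutations by the number of non-descents. -/
noncomputable def simsunPoly {R : Type*} [CommRing R] (m : ℕ) (x : R) : R :=
  ∑ w ∈ simsunPerms m, x ^ (m - permDes w)

open Classical in
theorem simsunPoly_eq_list_sum {R : Type*} [CommRing R] (m : ℕ) (x : R) :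
    simsunPoly m x = ((List.permutations' (descendingWord m)).map fun l =>
      if IsSimsunWord l then x ^ nonDescents l else 0).sum := by
  rw [← sum_permWord, simsunPoly, simsunPerms, Finset.sum_filter]
  refine Finset.sum_congr rfl fun w _ => ?_
  rw [nonDescents_permWord]
  rfl

-- A word with k non-descents contributes (m+1-k)X^{k+1} + (2k-m)X^k through its insertions; the
-- factors k become the operator X d/dX.
open Polynomial in
theorem simsunPoly_succ {R : Type*} [CommRing R] (m : ℕ) :
    simsunPoly (m + 1) (X : R[X]) = (((m : R[X]) + 1) * X - (m : R[X])) * simsunPoly m (X : R[X]) +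
      (2 - X) * X * derivative (simsunPoly m (X : R[X])) := by
  classical
  have hD : ∀ L : List (List ℕ), derivative (L.map fun l =>
      if IsSimsunWord l then (X : R[X]) ^ nonDescents l else 0).sum =
      (L.map fun l => if IsSimsunWord l then derivative ((X : R[X]) ^ nonDescents l) else 0).sum := by
    intro L
    induction L with
    | nil => simp
    | cons a L ih =>
      simp only [List.map_cons, List.sum_cons, derivative_add, ih]
      split_ifs <;> simp
  have hF : ∀ (L : List (List ℕ)) (f : List ℕ → List R[X]),
      (L.flatMap f).sum = (L.map fun l => (f l).sum).sum := by
    intro L f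
    induction L with
    | nil => simp
    | cons a L ih => simp [ih]
  rw [simsunPoly_eq_list_sum, simsunPoly_eq_list_sum, hD, ← List.sum_map_mul_left,
    ← List.sum_map_mul_left, ← List.sum_map_add]
  rw [descendingWord, List.permutations', List.map_flatMap, hF]
  congr 1
  apply List.map_congr_left
  intro l hl
  rw [List.mem_permutations'] at hl
  have hm : ∀ a ∈ l, a ≤ m := fun a ha => (mem_descendingWord.1 (hl.mem_iff.1 ha)).2
  have hlen : l.length = m := by rw [hl.length_eq, length_descendingWord]
  by_cases hs : IsSimsunWord l
  · have e : (List.permutations'Aux (m + 1) l).map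
        (fun l => if IsSimsunWord l then (X : R[X]) ^ nonDescents l else 0) =
        (List.permutations'Aux (m + 1) l).map (descentWeight (X : R[X])) := by
      apply List.map_congr_left
      intro l' hl'
      rw [descentWeight, isSimsunWord_of_mem_permutations'Aux hm hl']
      by_cases h : HasDoubleDescent l' <;> simp [h, hs]
    rw [e, sum_descentWeight_permutations'Aux _ _ _ (hs.not_hasDoubleDescent hm)
      (fun a ha => Nat.lt_succ_of_le (hm a ha)), hlen, if_pos hs, if_pos hs]
    have hd : X * derivative ((X : R[X]) ^ nonDescents l) =
        (nonDescents l : R[X]) * X ^ nonDescents l := by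
      rw [derivative_X_pow]
      cases nonDescents l with
      | zero => simp
      | succ k => simp; ring
    rw [mul_assoc, hd]
    ring
  · have e : (List.permutations'Aux (m + 1) l).map
        (fun l => if IsSimsunWord l then (X : R[X]) ^ nonDescents l else 0) =
        (List.permutations'Aux (m + 1) l).map (fun _ => 0) := by
      apply List.map_congr_left
      intro l' hl'
      rw [isSimsunWord_of_mem_permutations'Aux hm hl', if_neg (by tauto)]
    rw [e]
    simp [hs]

theorem simsunPoly_zero {R : Type*} [CommRing R] (x : R) : simsunPoly 0 x = 1 := by
  classical
  rw [simsunPoly_eq_list_sum]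
  have : IsSimsunWord [] := fun j => by simpa using not_hasDoubleDescent_nil
  simp [descendingWord, List.permutations', this, nonDescents]
/-! ### Exponential generating functions with polynomial coefficients -/

open Polynomial in
/-- Coefficientwise derivative of a power series with polynomial coefficients. -/
noncomputable def coeffDeriv (f : PowerSeries ℚ[X]) : PowerSeries ℚ[X] :=
  PowerSeries.mk fun n => derivative (PowerSeries.coeff n f)

open Polynomial in
theorem coeff_coeffDeriv (f : PowerSeries ℚ[X]) (n : ℕ) :
    PowerSeries.coeff n (coeffDeriv f) = derivative (PowerSeries.coeff n f) := by
  simp [coeffDeriv]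

open Polynomial in
theorem coeffDeriv_add (f g : PowerSeries ℚ[X]) :
    coeffDeriv (f + g) = coeffDeriv f + coeffDeriv g := by
  ext1 n
  simp [coeff_coeffDeriv]

open Polynomial in
theorem coeffDeriv_sub (f g : PowerSeries ℚ[X]) :
    coeffDeriv (f - g) = coeffDeriv f - coeffDeriv g := by
  ext1 n
  simp [coeff_coeffDeriv]

open Polynomial in
theorem coeffDeriv_mul (f g : PowerSeries ℚ[X]) :
    coeffDeriv (f * g) = coeffDeriv f * g + f * coeffDeriv g := by
  ext1 n
  simp only [coeff_coeffDeriv, PowerSeries.coeff_mul, map_add, derivative_sum, derivative_mul,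
    Finset.sum_add_distrib]

open Polynomial in
theorem coeffDeriv_C (p : ℚ[X]) :
    coeffDeriv (PowerSeries.C p) = PowerSeries.C (derivative p) := by
  ext1 n
  simp only [coeff_coeffDeriv, PowerSeries.coeff_C]
  split_ifs <;> simp

open Polynomial in
theorem derivative_coeffDeriv (f : PowerSeries ℚ[X]) :
    PowerSeries.derivative ℚ[X] (coeffDeriv f) = coeffDeriv (PowerSeries.derivative ℚ[X] f) := by
  ext1 n
  have : ((n : ℚ[X]) + 1) = ((n + 1 : ℕ) : ℚ[X]) := by push_cast; rfl
  rw [PowerSeries.coeff_derivative, coeff_coeffDeriv, coeff_coeffDeriv,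
    PowerSeries.coeff_derivative, derivative_mul, this, derivative_natCast, mul_zero, add_zero]

-- The equation expresses (n+1) times coefficient n+1 through the earlier coefficients, so they all
-- vanish in turn.
open Polynomial in
theorem powerSeries_eq_zero_of_derivative_eq_mul (K u : PowerSeries ℚ[X])
    (h0 : PowerSeries.coeff 0 K = 0) (h : PowerSeries.derivative ℚ[X] K = u * K) : K = 0 := by
  have key : ∀ n, PowerSeries.coeff n K = 0 := by
    intro n
    induction n using Nat.strong_induction_on with
    | _ n ih =>
      cases n with
      | zero => exact h0
      | succ n =>
        have e := congrArg (PowerSeries.coeff n) h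
        rw [PowerSeries.coeff_derivative, PowerSeries.coeff_mul, Finset.sum_eq_zero] at e
        · rcases mul_eq_zero.1 e with e | e
          · exact e
          · exact absurd e (by exact_mod_cast Nat.succ_ne_zero n)
        · intro p hp
          rw [ih p.2 (by have := Finset.HasAntidiagonal.mem_antidiagonal.1 hp; omega), mul_zero]
  ext1 n
  simp [key]

open Polynomial in
/-- The first order linear differential equation implies a Riccati equation. -/
theorem riccati_of_linear_pde (F : PowerSeries ℚ[X]) (a : PowerSeries ℚ[X])
    (ha : a = PowerSeries.C (X - 1))
    (h0 : PowerSeries.coeff 0 F = 1)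
    (h : (1 - a * PowerSeries.X) * PowerSeries.derivative ℚ[X] F =
      1 + a * F + (1 - a ^ 2) * coeffDeriv F) :
    2 * PowerSeries.derivative ℚ[X] F = 2 * a * F + F ^ 2 + 1 := by
  set D := PowerSeries.derivative ℚ[X] with hD
  -- H is the defect of the Riccati equation. It satisfies a homogeneous linear equation of the same
  -- type and has no constant term, so it vanishes.
  set H := 2 * D F - 2 * a * F - F * F - 1 with hH
  have hDa : D a = 0 := by rw [ha, hD, PowerSeries.derivative_C]
  have hca : coeffDeriv a = 1 := by
    rw [ha, coeffDeriv_C]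
    simp
  have hc1 : coeffDeriv 1 = 0 := by
    have := coeffDeriv_C 1
    simpa using this
  have hc2 : coeffDeriv 2 = 0 := by
    have : (2 : PowerSeries ℚ[X]) = 1 + 1 := by norm_num
    rw [this, coeffDeriv_add, hc1, add_zero]
  have hDD := congrArg D h
  have hD2 : D (2 : PowerSeries ℚ[X]) = 0 := by
    have : (2 : PowerSeries ℚ[X]) = 1 + 1 := by norm_num
    rw [this, map_add, hD, PowerSeries.derivative_one, add_zero]
  have hD1 : D (1 : PowerSeries ℚ[X]) = 0 := PowerSeries.derivative_one
  have hDX : D (PowerSeries.X : PowerSeries ℚ[X]) = 1 := PowerSeries.derivative_X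
  simp only [Derivation.leibniz, map_add, map_sub, hDa, hD1, hDX, pow_two, smul_eq_mul] at hDD
  rw [hD, derivative_coeffDeriv, ← hD] at hDD
  have hpde : (1 - a * PowerSeries.X) * D H - (1 - a ^ 2) * coeffDeriv H = 2 * a * H := by
    have e1 : D H = 2 * D (D F) - 2 * a * D F - 2 * F * D F := by
      rw [hH]
      simp only [Derivation.leibniz, map_sub, hDa, hD1, hD2, smul_eq_mul]
      ring
    have e2 : coeffDeriv H = 2 * coeffDeriv (D F) - 2 * F - 2 * a * coeffDeriv F -
        2 * F * coeffDeriv F := by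
      rw [hH]
      simp only [coeffDeriv_sub, coeffDeriv_mul, hca, hc1, hc2]
      ring
    rw [e1, e2, hH]
    linear_combination 2 * hDD - (2 * a + 2 * F) * h
  -- At order n, `hpde` expresses (n+1) times coefficient n+1 through coefficient n and its
  -- derivative in t.
  have key : ∀ n, PowerSeries.coeff n H = 0 := by
    intro n
    induction n with
    | zero =>
      have e := congrArg (PowerSeries.coeff 0) h
      have h2 : (2 : PowerSeries ℚ[X]) = PowerSeries.C 2 := (map_ofNat _ 2).symm
      have c2 : PowerSeries.constantCoeff (coeffDeriv F) = 0 := by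
        rw [← PowerSeries.coeff_zero_eq_constantCoeff_apply, coeff_coeffDeriv, h0, derivative_one]
      rw [PowerSeries.coeff_zero_eq_constantCoeff_apply] at h0 e ⊢
      rw [PowerSeries.coeff_zero_eq_constantCoeff_apply] at e
      rw [hH, h2]
      simp only [map_mul, map_sub, map_add, map_one, PowerSeries.constantCoeff_X, c2, h0,
        PowerSeries.constantCoeff_C] at e ⊢
      linear_combination 2 * e
    | succ n ih =>
      have e := congrArg (PowerSeries.coeff n) hpde
      have c0 : PowerSeries.coeff n (PowerSeries.X * D H) =
          PowerSeries.coeff n H * n := by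
        cases n with
        | zero => simp
        | succ n =>
          rw [PowerSeries.coeff_succ_X_mul, hD, PowerSeries.coeff_derivative]
          push_cast; rfl
      have c1 : (1 - a * PowerSeries.X) * D H = D H - a * (PowerSeries.X * D H) := by ring
      have c2 : (1 - a ^ 2) * coeffDeriv H = PowerSeries.C (1 - (X - 1) ^ 2) * coeffDeriv H := by
        rw [ha]; simp
      have c3 : 2 * a * H = PowerSeries.C (2 * (X - 1)) * H := by
        rw [ha, map_mul, map_ofNat]
      rw [c1, c2, c3, ha] at e
      rw [LinearMap.map_sub, LinearMap.map_sub, PowerSeries.coeff_C_mul, PowerSeries.coeff_C_mul, PowerSeries.coeff_C_mul,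
        coeff_coeffDeriv, c0, ih, hD,
        PowerSeries.coeff_derivative] at e
      simp only [derivative_zero, zero_mul, mul_zero, sub_zero] at e
      rcases mul_eq_zero.1 e with e | e
      · exact e
      · exact absurd e (by exact_mod_cast Nat.succ_ne_zero n)
  have hzero : H = 0 := by
    ext1 n
    simp [key]
  rw [hH] at hzero
  linear_combination hzero

open Polynomial in
/-- The Riccati equation implies the functional equation `F(x) F(-x) = 1`. -/
theorem mul_rescale_neg_eq_one (F a : PowerSeries ℚ[X]) (ha : a = PowerSeries.C (X - 1))
    (h0 : PowerSeries.coeff 0 F = 1)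
    (h : 2 * PowerSeries.derivative ℚ[X] F = 2 * a * F + F ^ 2 + 1) :
    F * PowerSeries.rescale (-1) F = 1 := by
  set D := PowerSeries.derivative ℚ[X] with hD
  set G := PowerSeries.rescale (-1 : ℚ[X]) F with hG
  have hDG : D G = - PowerSeries.rescale (-1 : ℚ[X]) (D F) := by
    ext1 n
    rw [hG, hD, PowerSeries.coeff_derivative, PowerSeries.coeff_rescale, map_neg,
      PowerSeries.coeff_rescale, PowerSeries.coeff_derivative]
    ring
  have hra : PowerSeries.rescale (-1 : ℚ[X]) a = a := by
    ext1 n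
    rw [ha, PowerSeries.coeff_rescale, PowerSeries.coeff_C]
    split_ifs with hn <;> simp [hn]
  have hDG' : 2 * D G = -(2 * a * G + G ^ 2 + 1) := by
    have e := congrArg (PowerSeries.rescale (-1 : ℚ[X])) h
    simp only [map_mul, map_add, map_pow, map_one, hra, map_ofNat, ← hG] at e
    rw [hDG]
    linear_combination -e
  have hhalf : (2 : PowerSeries ℚ[X]) * PowerSeries.C (Polynomial.C (1 / 2)) = 1 := by
    have h2 : (2 : PowerSeries ℚ[X]) = PowerSeries.C (Polynomial.C 2) := by
      rw [map_ofNat, map_ofNat]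
    rw [h2, ← map_mul, ← map_mul]
    norm_num
  have hK : F * G - 1 = 0 := by
    -- Combining the two Riccati equations cancels the terms in a and leaves 2(FG)' = (F - G)(FG -
    -- 1).
    apply powerSeries_eq_zero_of_derivative_eq_mul _ (PowerSeries.C (Polynomial.C (1 / 2)) * (F - G))
    · rw [PowerSeries.coeff_zero_eq_constantCoeff_apply] at h0 ⊢
      have : PowerSeries.constantCoeff G = 1 := by
        rw [← PowerSeries.coeff_zero_eq_constantCoeff_apply, hG, PowerSeries.coeff_rescale,
          PowerSeries.coeff_zero_eq_constantCoeff_apply, h0]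
        simp
      simp [h0, this]
    · have hD1 : D (1 : PowerSeries ℚ[X]) = 0 := PowerSeries.derivative_one
      rw [← hD]
      simp only [Derivation.leibniz, map_sub, hD1, smul_eq_mul]
      set c := PowerSeries.C (Polynomial.C (1 / 2 : ℚ)) with hc
      linear_combination (c * F) * hDG' + (c * G) * h - (F * D G + G * D F) * hhalf
  linear_combination hK

open Polynomial in
/-- A sequence of polynomials satisfying the derivative recurrence satisfies a convolution
recurrence involving only the terms of even index. -/
theorem convolution_of_derivative_recurrence (g : ℕ → ℚ[X]) (h0 : g 0 = 1) (h1 : g 1 = X)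
    (h : ∀ n, g (n + 2) = ((n : ℚ[X]) + 2) * (X - 1) * g (n + 1) +
      X * (2 - X) * derivative (g (n + 1))) (n : ℕ) :
    g (n + 1) = (X - 1) * g n +
      ∑ p ∈ Finset.HasAntidiagonal.antidiagonal n, ((n.choose p.1 : ℕ) : ℚ[X]) *
        (if Even p.1 then g p.1 else 0) * g p.2 := by
  set F : PowerSeries ℚ[X] := PowerSeries.mk fun n => Polynomial.C (1 / (n.factorial : ℚ)) * g n
    with hF
  set a : PowerSeries ℚ[X] := PowerSeries.C (X - 1) with ha
  have hF0 : PowerSeries.coeff 0 F = 1 := by simp [hF, h0]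
  have hfac : ∀ n : ℕ, Polynomial.C (1 / ((n + 1).factorial : ℚ)) * ((n : ℚ[X]) + 1) =
      Polynomial.C (1 / (n.factorial : ℚ)) := by
    intro n
    have : ((n : ℚ[X]) + 1) = Polynomial.C ((n : ℚ) + 1) := by simp
    rw [this, ← Polynomial.C_mul, Nat.factorial_succ]
    congr 1
    have h1 : (n.factorial : ℚ) ≠ 0 := by exact_mod_cast n.factorial_ne_zero
    have h2 : (n : ℚ) + 1 ≠ 0 := by positivity
    push_cast
    field_simp
  have hDF : ∀ n, PowerSeries.coeff n (PowerSeries.derivative ℚ[X] F) =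
      Polynomial.C (1 / (n.factorial : ℚ)) * g (n + 1) := by
    intro n
    rw [PowerSeries.coeff_derivative, hF, PowerSeries.coeff_mk, ← hfac n]
    ring
  -- Here 1 - a^2 = X(2 - X). The recurrence starts only at g 2; the constant 1 on the right
  -- accounts for g 1 = X at order zero.
  have hpde : (1 - a * PowerSeries.X) * PowerSeries.derivative ℚ[X] F =
      1 + a * F + (1 - a ^ 2) * coeffDeriv F := by
    have c1 : (1 - a * PowerSeries.X) * PowerSeries.derivative ℚ[X] F =
        PowerSeries.derivative ℚ[X] F - a * (PowerSeries.X * PowerSeries.derivative ℚ[X] F) := by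
      ring
    have c2 : (1 - a ^ 2) = PowerSeries.C (1 - (X - 1) ^ 2 : ℚ[X]) := by rw [ha]; simp
    rw [c1, c2]
    ext1 n
    rw [map_sub, map_add, map_add, ha, PowerSeries.coeff_C_mul, PowerSeries.coeff_C_mul,
      PowerSeries.coeff_C_mul, coeff_coeffDeriv, hDF]
    cases n with
    | zero => simp [hF, h0, h1]
    | succ n =>
      rw [PowerSeries.coeff_succ_X_mul, hDF, PowerSeries.coeff_one, if_neg (Nat.succ_ne_zero n),
        hF, PowerSeries.coeff_mk, derivative_C_mul, ← hfac n, h n]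
      ring
  have hric := riccati_of_linear_pde F a ha hF0 hpde
  have hinv := mul_rescale_neg_eq_one F a ha hF0 hric
  set G := PowerSeries.rescale (-1 : ℚ[X]) F with hG
  -- Substituting FG for 1 turns F^2 + 1 into (F + G)F, where F + G is twice the even part of F.
  have hfin : 2 * PowerSeries.derivative ℚ[X] F = 2 * (a * F) + (F + G) * F := by
    linear_combination hric - hinv
  have hFG : F + G = 2 * PowerSeries.mk fun n =>
      Polynomial.C (1 / (n.factorial : ℚ)) * if Even n then g n else 0 := by
    have h2 : (2 : PowerSeries ℚ[X]) = PowerSeries.C 2 := (map_ofNat _ 2).symm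
    ext1 n
    rw [h2, PowerSeries.coeff_C_mul, map_add, hG, PowerSeries.coeff_rescale, hF,
      PowerSeries.coeff_mk, PowerSeries.coeff_mk]
    split_ifs with hn
    · rw [hn.neg_one_pow]; ring
    · rw [(Nat.not_even_iff_odd.1 hn).neg_one_pow]; ring
  have h2ne : (2 : PowerSeries ℚ[X]) ≠ 0 := by
    have h2 : (2 : PowerSeries ℚ[X]) = PowerSeries.C 2 := (map_ofNat _ 2).symm
    intro h
    have := congrArg PowerSeries.constantCoeff (h2.symm.trans h)
    simp at this
  rw [hFG, mul_assoc, ← mul_add] at hfin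
  have e := congrArg (PowerSeries.coeff n) (mul_left_cancel₀ h2ne hfin)
  rw [hDF, map_add, ha, PowerSeries.coeff_C_mul, PowerSeries.coeff_mul, hF,
    PowerSeries.coeff_mk] at e
  have hn : Polynomial.C (n.factorial : ℚ) * Polynomial.C (1 / (n.factorial : ℚ)) = 1 := by
    have h1 : (n.factorial : ℚ) ≠ 0 := by exact_mod_cast n.factorial_ne_zero
    rw [← Polynomial.C_mul, mul_one_div_cancel h1, Polynomial.C_1]
  have hs : ∑ p ∈ Finset.HasAntidiagonal.antidiagonal n, ((n.choose p.1 : ℕ) : ℚ[X]) *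
        (if Even p.1 then g p.1 else 0) * g p.2 = Polynomial.C (n.factorial : ℚ) *
      ∑ p ∈ Finset.HasAntidiagonal.antidiagonal n, PowerSeries.coeff p.1 (PowerSeries.mk fun n =>
      Polynomial.C (1 / (n.factorial : ℚ)) * if Even n then g n else 0) *
      PowerSeries.coeff p.2 (PowerSeries.mk fun n => Polynomial.C (1 / (n.factorial : ℚ)) * g n) := by
    rw [Finset.mul_sum]
    refine Finset.sum_congr rfl fun p hp => ?_
    rw [Finset.HasAntidiagonal.mem_antidiagonal] at hp
    have hc : ((n.choose p.1 : ℕ) : ℚ[X]) = Polynomial.C (n.factorial : ℚ) *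
        Polynomial.C (1 / (p.1.factorial : ℚ)) * Polynomial.C (1 / (p.2.factorial : ℚ)) := by
      rw [← Polynomial.C_mul, ← Polynomial.C_mul, ← Polynomial.C_eq_natCast]
      congr 1
      have h1 : (p.1.factorial : ℚ) ≠ 0 := by exact_mod_cast p.1.factorial_ne_zero
      have h2 : (p.2.factorial : ℚ) ≠ 0 := by exact_mod_cast p.2.factorial_ne_zero
      field_simp
      have := Nat.choose_mul_factorial_mul_factorial (show p.1 ≤ n by omega)
      rw [show n - p.1 = p.2 by omega] at this
      exact_mod_cast this
    rw [hc, PowerSeries.coeff_mk, PowerSeries.coeff_mk]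
    ring
  rw [hs]
  linear_combination Polynomial.C (n.factorial : ℚ) * e + ((X - 1) * g n - g (n + 1)) * hn
/-! ### Forests as strict orders -/

/-- A rooted forest on the vertex set `V`, encoded by the set `A` of pairs `(i, j)` such that `j`
is a proper ancestor of `i`: a strict partial order in which the elements above a given one form
a chain. -/
structure IsForestOrder {α : Type*} (V : Finset α) (A : Finset (α × α)) : Prop where
  mem : ∀ i j, (i, j) ∈ A → i ∈ V ∧ j ∈ V
  irrefl : ∀ i, (i, i) ∉ A
  trans : ∀ i j k, (i, j) ∈ A → (j, k) ∈ A → (i, k) ∈ A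
  chain : ∀ i j k, (i, j) ∈ A → (i, k) ∈ A → j = k ∨ (j, k) ∈ A ∨ (k, j) ∈ A

open Classical in
/-- The rooted forests on the vertex set `V`. -/
noncomputable def forestOrders {α : Type*} (V : Finset α) : Finset (Finset (α × α)) :=
  (V ×ˢ V).powerset.filter fun A => IsForestOrder V A

theorem mem_forestOrders {α : Type*} {V : Finset α} {A : Finset (α × α)} :
    A ∈ forestOrders V ↔ IsForestOrder V A := by
  classical
  rw [forestOrders, Finset.mem_filter, Finset.mem_powerset]
  refine ⟨fun h => h.2, fun h => ⟨?_, h⟩⟩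
  rintro ⟨i, j⟩ hij
  exact Finset.mem_product.2 (h.mem i j hij)

open Classical in
/-- The number of inversions of a forest. -/
noncomputable def forestInv {α : Type*} [LinearOrder α] (A : Finset (α × α)) : ℕ :=
  (A.filter fun p => p.1 < p.2).card

open Classical in
/-- The number of leaves of a forest. -/
noncomputable def forestLev {α : Type*} (V : Finset α) (A : Finset (α × α)) : ℕ :=
  (V.filter fun v => ∀ u, (u, v) ∉ A).card

/-- The enumerator of forests by inversions and leaves. -/
noncomputable def forestSum {α : Type*} [LinearOrder α] {R : Type*} [CommRing R] (q t : R)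
    (V : Finset α) : R :=
  ∑ A ∈ forestOrders V, q ^ forestInv A * t ^ forestLev V A

theorem forestSum_empty {α : Type*} [LinearOrder α] {R : Type*} [CommRing R] (q t : R) :
    forestSum q t (∅ : Finset α) = 1 := by
  have : forestOrders (∅ : Finset α) = {∅} := by
    ext A
    rw [mem_forestOrders, Finset.mem_singleton]
    constructor
    · intro h
      rw [Finset.eq_empty_iff_forall_notMem]
      rintro ⟨i, j⟩ hij
      simpa using h.mem i j hij
    · rintro rfl
      constructor <;> simp
  simp [forestSum, this, forestInv, forestLev]

open Classical in
/-- The descendants of `v`. -/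
noncomputable def forestDesc {α : Type*} (V : Finset α) (A : Finset (α × α)) (v : α) : Finset α :=
  V.filter fun u => (u, v) ∈ A

/-- The descendant count is strictly monotone along the order, so roots, leaves and parents can be
found as extremal elements. -/
theorem IsForestOrder.card_desc_lt {α : Type*} {V : Finset α} {A : Finset (α × α)}
    (h : IsForestOrder V A) {i j : α} (hij : (i, j) ∈ A) :
    (forestDesc V A i).card < (forestDesc V A j).card := by
  classical
  apply Finset.card_lt_card
  rw [Finset.ssubset_iff_of_subset]
  · refine ⟨i, ?_, ?_⟩
    · simp [forestDesc, hij, (h.mem i j hij).1]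
    · simp [forestDesc, h.irrefl]
  · intro u hu
    simp only [forestDesc, Finset.mem_filter] at hu ⊢
    exact ⟨hu.1, h.trans u i j hu.2 hij⟩

theorem IsForestOrder.exists_root {α : Type*} {V : Finset α} {A : Finset (α × α)}
    (h : IsForestOrder V A) {M : α} (hM : M ∈ V) :
    ∃ r ∈ V, (M = r ∨ (M, r) ∈ A) ∧ ∀ x, (r, x) ∉ A := by
  classical
  obtain ⟨r, hr, hmax⟩ := Finset.exists_max_image (V.filter fun x => M = x ∨ (M, x) ∈ A)
    (fun v => (forestDesc V A v).card) ⟨M, by simp [hM]⟩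
  rw [Finset.mem_filter] at hr
  refine ⟨r, hr.1, hr.2, fun x hx => ?_⟩
  have h1 := h.card_desc_lt hx
  have h2 := hmax x (by
    rw [Finset.mem_filter]
    refine ⟨(h.mem r x hx).2, Or.inr ?_⟩
    rcases hr.2 with rfl | h3
    · exact hx
    · exact h.trans _ _ _ h3 hx)
  omega

theorem IsForestOrder.one_le_lev {α : Type*} {V : Finset α} {A : Finset (α × α)}
    (h : IsForestOrder V A) (hV : V.Nonempty) : 1 ≤ forestLev V A := by
  classical
  obtain ⟨r, hr, hmin⟩ := Finset.exists_min_image V (fun v => (forestDesc V A v).card) hV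
  rw [forestLev, Nat.one_le_iff_ne_zero, Finset.card_ne_zero]
  refine ⟨r, Finset.mem_filter.2 ⟨hr, fun u hu => ?_⟩⟩
  have h1 := h.card_desc_lt hu
  have h2 := hmin u (h.mem u r hu).1
  omega

/-! ### Splitting off the component of a marked vertex -/

/-- The forest with a component on the vertex set `S` with root `r`, obtained from forests on the
other vertices of `S` and on the complement of `S`. -/
noncomputable def graftForest {α : Type*} [DecidableEq α] (S : Finset α) (r : α) (A B : Finset (α × α)) :
    Finset (α × α) :=
  A ∪ B ∪ (S.erase r) ×ˢ {r}

theorem mem_graftForest {α : Type*} [DecidableEq α] {S : Finset α} {r : α} {A B : Finset (α × α)} {i j : α} :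
    (i, j) ∈ graftForest S r A B ↔
      (i, j) ∈ A ∨ (i, j) ∈ B ∨ (i ∈ S ∧ i ≠ r ∧ j = r) := by
  classical
  simp only [graftForest, Finset.mem_union, Finset.mem_product, Finset.mem_erase,
    Finset.mem_singleton]
  tauto

theorem isForestOrder_graftForest {α : Type*} [DecidableEq α] {V S : Finset α} {r : α} {A B : Finset (α × α)}
    (hS : S ⊆ V) (hr : r ∈ S) (hA : IsForestOrder (S.erase r) A) (hB : IsForestOrder (V \ S) B) :
    IsForestOrder V (graftForest S r A B) := by
  have a1 := hA.mem
  have b1 := hB.mem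
  simp only [Finset.mem_erase, Finset.mem_sdiff] at a1 b1
  constructor
  · intro i j
    rw [mem_graftForest]
    rintro (h | h | ⟨h1, h2, rfl⟩)
    · exact ⟨hS (a1 _ _ h).1.2, hS (a1 _ _ h).2.2⟩
    · exact ⟨(b1 _ _ h).1.1, (b1 _ _ h).2.1⟩
    · exact ⟨hS h1, hS hr⟩
  · intro i
    rw [mem_graftForest]
    rintro (h | h | ⟨h1, h2, rfl⟩)
    · exact hA.irrefl _ h
    · exact hB.irrefl _ h
    · exact h2 rfl
  · intro i j k
    simp only [mem_graftForest]
    rintro (h | h | ⟨h1, h2, rfl⟩) (h' | h' | ⟨h1', h2', rfl⟩)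
    · exact Or.inl (hA.trans _ _ _ h h')
    · exact absurd (a1 _ _ h).2.2 (b1 _ _ h').1.2
    · exact Or.inr (Or.inr ⟨(a1 _ _ h).1.2, (a1 _ _ h).1.1, rfl⟩)
    · exact absurd (a1 _ _ h').1.2 (b1 _ _ h).2.2
    · exact Or.inr (Or.inl (hB.trans _ _ _ h h'))
    · exact absurd h1' (b1 _ _ h).2.2
    · exact absurd rfl (a1 _ _ h').1.1
    · exact absurd hr (b1 _ _ h').1.2
    · exact absurd rfl h2'
  · intro i j k
    simp only [mem_graftForest]
    rintro (h | h | ⟨h1, h2, rfl⟩) (h' | h' | ⟨h1', h2', rfl⟩)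
    · rcases hA.chain _ _ _ h h' with h | h | h <;> tauto
    · exact absurd (a1 _ _ h).1.2 (b1 _ _ h').1.2
    · exact Or.inr (Or.inl (Or.inr (Or.inr ⟨(a1 _ _ h).2.2, (a1 _ _ h).2.1, rfl⟩)))
    · exact absurd (a1 _ _ h').1.2 (b1 _ _ h).1.2
    · rcases hB.chain _ _ _ h h' with h | h | h <;> tauto
    · exact absurd h1' (b1 _ _ h).1.2
    · exact Or.inr (Or.inr (Or.inr (Or.inr ⟨(a1 _ _ h').2.2, (a1 _ _ h').2.1, rfl⟩)))
    · exact absurd h1 (b1 _ _ h').1.2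
    · exact Or.inl rfl

theorem exists_graftForest_eq {α : Type*} [DecidableEq α] {V : Finset α} {M : α} {A : Finset (α × α)}
    (h : IsForestOrder V A) (hM : M ∈ V) :
    ∃ S r B C, S ⊆ V ∧ M ∈ S ∧ r ∈ S ∧ IsForestOrder (S.erase r) B ∧
      IsForestOrder (V \ S) C ∧ graftForest S r B C = A := by
  classical
  obtain ⟨r, hr, hMr, htop⟩ := h.exists_root hM
  -- The component is r with all its descendants. No pair of A crosses its boundary: by the chain
  -- condition, an ancestor of a descendant of r is comparable with r, and nothing lies above r.
  refine ⟨V.filter fun i => i = r ∨ (i, r) ∈ A, r,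
    A.filter fun p => (p.1, r) ∈ A ∧ (p.2, r) ∈ A,
    A.filter fun p => (p.1 ≠ r ∧ (p.1, r) ∉ A) ∧ (p.2 ≠ r ∧ (p.2, r) ∉ A), ?_, ?_, ?_, ?_, ?_, ?_⟩
  · exact Finset.filter_subset _ _
  · simp [hM, hMr]
  · simp [hr]
  · constructor
    · intro i j hij
      simp only [Finset.mem_filter, Finset.mem_erase] at hij ⊢
      have h1 := h.mem _ _ hij.1
      refine ⟨⟨?_, h1.1, Or.inr hij.2.1⟩, ⟨?_, h1.2, Or.inr hij.2.2⟩⟩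
      · rintro rfl; exact htop _ hij.1
      · rintro rfl; exact htop _ hij.2.2
    · intro i hi
      exact h.irrefl i (Finset.mem_filter.1 hi).1
    · intro i j k hij hjk
      simp only [Finset.mem_filter] at hij hjk ⊢
      exact ⟨h.trans _ _ _ hij.1 hjk.1, hij.2.1, hjk.2.2⟩
    · intro i j k hij hik
      simp only [Finset.mem_filter] at hij hik ⊢
      rcases h.chain _ _ _ hij.1 hik.1 with h | h | h <;> tauto
  · constructor
    · intro i j hij
      simp only [Finset.mem_filter, Finset.mem_sdiff] at hij ⊢
      have h1 := h.mem _ _ hij.1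
      tauto
    · intro i hi
      exact h.irrefl i (Finset.mem_filter.1 hi).1
    · intro i j k hij hjk
      simp only [Finset.mem_filter] at hij hjk ⊢
      exact ⟨h.trans _ _ _ hij.1 hjk.1, hij.2.1, hjk.2.2⟩
    · intro i j k hij hik
      simp only [Finset.mem_filter] at hij hik ⊢
      rcases h.chain _ _ _ hij.1 hik.1 with h | h | h <;> tauto
  · ext ⟨i, j⟩
    simp only [mem_graftForest, Finset.mem_filter]
    constructor
    · rintro (h1 | h1 | ⟨⟨h1, h2⟩, h3, rfl⟩)
      · exact h1.1
      · exact h1.1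
      · tauto
    · intro hij
      have h1 := (h.mem _ _ hij)
      have hir : i ≠ r := by rintro rfl; exact htop _ hij
      have hrj := htop j
      by_cases hi : (i, r) ∈ A
      · rcases h.chain _ _ _ hij hi with h2 | h2 | h2 <;> tauto
      · have hj : j ≠ r := by rintro rfl; exact hi hij
        have hj' : (j, r) ∉ A := fun hj' => hi (h.trans _ _ _ hij hj')
        tauto

/-- The chain condition allows only one maximal element at or above M, which recovers the root. Its
descendants recover S, and A and B are then read off inside and outside S. -/
theorem graftForest_injective {α : Type*} [DecidableEq α] {V : Finset α} {M : α} {S S' : Finset α} {r r' : α}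
    {A B A' B' : Finset (α × α)} (hS : S ⊆ V) (hM : M ∈ S) (hr : r ∈ S)
    (hA : IsForestOrder (S.erase r) A) (hB : IsForestOrder (V \ S) B)
    (hM' : M ∈ S') (hr' : r' ∈ S')
    (hA' : IsForestOrder (S'.erase r') A') (hB' : IsForestOrder (V \ S') B')
    (h : graftForest S r A B = graftForest S' r' A' B') :
    S = S' ∧ r = r' ∧ A = A' ∧ B = B' := by
  have hF := isForestOrder_graftForest hS hr hA hB
  have mem1 : ∀ i j, (i, j) ∈ graftForest S r A B ↔
      (i, j) ∈ A ∨ (i, j) ∈ B ∨ (i ∈ S ∧ i ≠ r ∧ j = r) := fun i j => mem_graftForest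
  have mem2 : ∀ i j, (i, j) ∈ graftForest S r A B ↔
      (i, j) ∈ A' ∨ (i, j) ∈ B' ∨ (i ∈ S' ∧ i ≠ r' ∧ j = r') := fun i j => by
    rw [h]; exact mem_graftForest
  have a1 := hA.mem
  have b1 := hB.mem
  have a1' := hA'.mem
  have b1' := hB'.mem
  simp only [Finset.mem_erase, Finset.mem_sdiff] at a1 b1 a1' b1'
  have top1 : ∀ x, (r, x) ∉ graftForest S r A B := fun x hx => by
    rcases (mem1 _ _).1 hx with hx | hx | hx
    · exact (a1 _ _ hx).1.1 rfl
    · exact (b1 _ _ hx).1.2 hr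
    · exact hx.2.1 rfl
  have top2 : ∀ x, (r', x) ∉ graftForest S r A B := fun x hx => by
    rcases (mem2 _ _).1 hx with hx | hx | hx
    · exact (a1' _ _ hx).1.1 rfl
    · exact (b1' _ _ hx).1.2 hr'
    · exact hx.2.1 rfl
  have hrr : r = r' := by
    by_cases h1 : M = r <;> by_cases h2 : M = r'
    · exact h1.symm.trans h2
    · exact absurd ((mem2 M r').2 (Or.inr (Or.inr ⟨hM', h2, rfl⟩))) (h1 ▸ top1 r')
    · exact absurd ((mem1 M r).2 (Or.inr (Or.inr ⟨hM, h1, rfl⟩))) (h2 ▸ top2 r)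
    · rcases hF.chain M r r' ((mem1 M r).2 (Or.inr (Or.inr ⟨hM, h1, rfl⟩)))
        ((mem2 M r').2 (Or.inr (Or.inr ⟨hM', h2, rfl⟩))) with h3 | h3 | h3
      · exact h3
      · exact absurd h3 (top1 _)
      · exact absurd h3 (top2 _)
  subst hrr
  have hSr : ∀ i, i ∈ S ↔ i = r ∨ (i, r) ∈ graftForest S r A B := fun i => by
    by_cases hi : i = r
    · simp [hi, hr]
    · rw [mem1]
      have := a1 i r
      have := b1 i r
      tauto
  have hSr' : ∀ i, i ∈ S' ↔ i = r ∨ (i, r) ∈ graftForest S r A B := fun i => by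
    by_cases hi : i = r
    · simp [hi, hr']
    · rw [mem2]
      have := a1' i r
      have := b1' i r
      tauto
  have hSS : S = S' := by
    ext i
    rw [hSr, hSr']
  subst hSS
  refine ⟨rfl, rfl, ?_, ?_⟩
  · ext ⟨i, j⟩
    have e := (mem1 i j).symm.trans (mem2 i j)
    have h1 := a1 i j
    have h2 := b1 i j
    have h3 := a1' i j
    have h4 := b1' i j
    tauto
  · ext ⟨i, j⟩
    have e := (mem1 i j).symm.trans (mem2 i j)
    have h1 := a1 i j
    have h2 := b1 i j
    have h3 := a1' i j
    have h4 := b1' i j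
    tauto

theorem forestInv_graftForest {α : Type*} [LinearOrder α] {V S : Finset α} {r : α}
    {A B : Finset (α × α)}
    (hr : r ∈ S) (hA : IsForestOrder (S.erase r) A) (hB : IsForestOrder (V \ S) B) :
    forestInv (graftForest S r A B) =
      forestInv A + forestInv B + (S.filter fun i => i < r).card := by
  have a1 := hA.mem
  have b1 := hB.mem
  simp only [Finset.mem_erase, Finset.mem_sdiff] at a1 b1
  have e : (S.filter fun i => i < r).card =
      ((S.erase r ×ˢ {r}).filter fun p : α × α => p.1 < p.2).card := by
    rw [← Finset.card_image_of_injective (S.filter fun i => i < r) (Prod.mk_left_injective r)]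
    congr 1
    ext ⟨i, j⟩
    simp only [Finset.mem_image, Finset.mem_filter, Finset.mem_product, Finset.mem_erase,
      Finset.mem_singleton, Prod.mk.injEq]
    constructor
    · rintro ⟨a, ⟨h1, h2⟩, rfl, rfl⟩
      exact ⟨⟨⟨h2.ne, h1⟩, rfl⟩, h2⟩
    · rintro ⟨⟨⟨h1, h2⟩, rfl⟩, h3⟩
      exact ⟨i, ⟨h2, h3⟩, rfl, rfl⟩
  rw [e, forestInv, forestInv, forestInv, graftForest, Finset.filter_union, Finset.filter_union,
    Finset.card_union_of_disjoint, Finset.card_union_of_disjoint]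
  · apply Finset.disjoint_filter_filter
    rw [Finset.disjoint_left]
    rintro ⟨i, j⟩ h1 h2
    exact (b1 _ _ h2).1.2 (a1 _ _ h1).1.2
  · rw [← Finset.filter_union]
    apply Finset.disjoint_filter_filter
    rw [Finset.disjoint_left]
    rintro ⟨i, j⟩ h1 h2
    simp only [Finset.mem_product, Finset.mem_erase, Finset.mem_singleton] at h2
    obtain ⟨⟨h3, h4⟩, rfl⟩ := h2
    rcases Finset.mem_union.1 h1 with h1 | h1
    · exact (a1 _ _ h1).2.1 rfl
    · exact (b1 _ _ h1).2.2 hr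

/-- Grafting changes no leaf status away from r, and r is a leaf exactly when it is alone in its
component. -/
theorem forestLev_graftForest {α : Type*} [DecidableEq α] {V S : Finset α} {r : α}
    {A B : Finset (α × α)} (hS : S ⊆ V)
    (hr : r ∈ S) (hA : IsForestOrder (S.erase r) A) (hB : IsForestOrder (V \ S) B) :
    forestLev V (graftForest S r A B) =
      forestLev (S.erase r) A + forestLev (V \ S) B + if S.erase r = ∅ then 1 else 0 := by
  classical
  have a1 := hA.mem
  have b1 := hB.mem
  simp only [Finset.mem_erase, Finset.mem_sdiff] at a1 b1
  have e : (if S.erase r = ∅ then 1 else 0) =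
      (Finset.filter (fun _ => S.erase r = ∅) {r}).card := by
    split_ifs with h <;> simp [h]
  have hU : V.filter (fun v => ∀ u, (u, v) ∉ graftForest S r A B) =
      ((S.erase r).filter fun v => ∀ u, (u, v) ∉ A) ∪ ((V \ S).filter fun v => ∀ u, (u, v) ∉ B) ∪
      Finset.filter (fun _ => S.erase r = ∅) {r} := by
    ext v
    simp only [Finset.mem_filter, Finset.mem_union, Finset.mem_erase, Finset.mem_sdiff,
      Finset.mem_singleton, mem_graftForest, Finset.eq_empty_iff_forall_notMem]
    constructor
    · rintro ⟨h1, h2⟩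
      by_cases h3 : v = r
      · refine Or.inr ⟨h3, fun x hx => h2 x ?_⟩
        exact Or.inr (Or.inr ⟨hx.2, hx.1, h3⟩)
      · left
        by_cases h4 : v ∈ S
        · exact Or.inl ⟨⟨h3, h4⟩, fun u hu => h2 u (Or.inl hu)⟩
        · exact Or.inr ⟨⟨h1, h4⟩, fun u hu => h2 u (Or.inr (Or.inl hu))⟩
    · rintro ((⟨⟨h1, h2⟩, h3⟩ | ⟨⟨h1, h2⟩, h3⟩) | ⟨h1, h2⟩)
      · refine ⟨hS h2, fun u hu => ?_⟩
        rcases hu with hu | hu | hu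
        · exact h3 u hu
        · exact (b1 _ _ hu).2.2 h2
        · exact h1 hu.2.2
      · refine ⟨h1, fun u hu => ?_⟩
        rcases hu with hu | hu | hu
        · exact h2 (a1 _ _ hu).2.2
        · exact h3 u hu
        · exact h2 (hu.2.2 ▸ hr)
      · subst h1
        refine ⟨hS hr, fun u hu => ?_⟩
        rcases hu with hu | hu | hu
        · exact (a1 _ _ hu).2.1 rfl
        · exact (b1 _ _ hu).2.2 hr
        · exact h2 u ⟨hu.2.1, hu.1⟩
  rw [e, forestLev, forestLev, forestLev, hU, Finset.card_union_of_disjoint,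
    Finset.card_union_of_disjoint]
  · rw [Finset.disjoint_left]
    intro v h1 h2
    simp only [Finset.mem_filter, Finset.mem_erase, Finset.mem_sdiff] at h1 h2
    exact h2.1.2 h1.1.2
  · rw [Finset.disjoint_left]
    intro v h1 h2
    simp only [Finset.mem_filter, Finset.mem_erase, Finset.mem_sdiff, Finset.mem_union,
      Finset.mem_singleton] at h1 h2
    obtain ⟨rfl, -⟩ := h2
    rcases h1 with h1 | h1
    · exact h1.1.1 rfl
    · exact h1.1.2 hr

/-- Fixing M selects one component, so each forest arises once from a choice of S, r and two smaller
forests. -/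
theorem forestSum_eq_sum_component {α : Type*} [LinearOrder α] {R : Type*} [CommRing R] (q t : R)
    {V : Finset α} {M : α} (hM : M ∈ V) :
    forestSum q t V = ∑ S ∈ V.powerset.filter (fun S => M ∈ S), ∑ r ∈ S,
      q ^ (S.filter fun i => i < r).card * ((if S.erase r = ∅ then t else 1) *
        forestSum q t (S.erase r)) * forestSum q t (V \ S) := by
  have e : ∀ S ∈ V.powerset.filter (fun S => M ∈ S), ∀ r ∈ S,
      q ^ (S.filter fun i => i < r).card * ((if S.erase r = ∅ then t else 1) *
        forestSum q t (S.erase r)) * forestSum q t (V \ S) =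
      ∑ A ∈ forestOrders (S.erase r), ∑ B ∈ forestOrders (V \ S),
        q ^ forestInv (graftForest S r A B) * t ^ forestLev V (graftForest S r A B) := by
    intro S hS r hr
    rw [Finset.mem_filter, Finset.mem_powerset] at hS
    rw [forestSum, forestSum, Finset.mul_sum (s := forestOrders (S.erase r)),
      Finset.mul_sum (s := forestOrders (S.erase r)), Finset.sum_mul]
    refine Finset.sum_congr rfl fun A hA => ?_
    rw [Finset.mul_sum]
    refine Finset.sum_congr rfl fun B hB => ?_
    rw [mem_forestOrders] at hA hB
    rw [forestInv_graftForest hr hA hB, forestLev_graftForest hS.1 hr hA hB]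
    split_ifs <;> ring
  rw [Finset.sum_congr rfl fun S hS => Finset.sum_congr rfl (e S hS)]
  simp only [Finset.sum_sigma']
  symm
  refine Finset.sum_bij (fun x _ => graftForest x.1 x.2.1 x.2.2.1 x.2.2.2) ?_ ?_ ?_ ?_
  · rintro ⟨S, r, A, B⟩ hx
    simp only [Finset.mem_sigma, Finset.mem_filter, Finset.mem_powerset, mem_forestOrders] at hx ⊢
    exact isForestOrder_graftForest hx.1.1 hx.2.1 hx.2.2.1 hx.2.2.2
  · rintro ⟨S, r, A, B⟩ hx ⟨S', r', A', B'⟩ hx' h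
    simp only [Finset.mem_sigma, Finset.mem_filter, Finset.mem_powerset, mem_forestOrders] at hx hx'
    obtain ⟨rfl, rfl, rfl, rfl⟩ := graftForest_injective hx.1.1 hx.1.2 hx.2.1 hx.2.2.1 hx.2.2.2
      hx'.1.2 hx'.2.1 hx'.2.2.1 hx'.2.2.2 h
    rfl
  · intro A hA
    rw [mem_forestOrders] at hA
    obtain ⟨S, r, B, C, h1, h2, h3, h4, h5, h6⟩ := exists_graftForest_eq hA hM
    refine ⟨⟨S, r, B, C⟩, ?_, h6⟩
    simp only [Finset.mem_sigma, Finset.mem_filter, Finset.mem_powerset, mem_forestOrders]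
    exact ⟨⟨h1, h2⟩, h3, h4, h5⟩
  · intros
    rfl

/-- The ranks of the elements of S run once through 0, …, |S| - 1. -/
theorem sum_card_filter_lt {α : Type*} [LinearOrder α] {M : Type*} [AddCommMonoid M] (f : ℕ → M)
    (S : Finset α) :
    ∑ r ∈ S, f (S.filter fun i => i < r).card = ∑ k ∈ Finset.range S.card, f k := by
  induction S using Finset.induction_on_max with
  | empty => simp
  | insert a S ha ih =>
    have haS : a ∉ S := fun h => lt_irrefl _ (ha a h)
    rw [Finset.sum_insert haS, Finset.card_insert_of_notMem haS, Finset.sum_range_succ, add_comm,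
      ← ih]
    congr 1
    · refine Finset.sum_congr rfl fun r hr => ?_
      rw [Finset.filter_insert, if_neg (ha r hr).not_gt]
    · rw [Finset.filter_insert, if_neg (lt_irrefl a), Finset.filter_true_of_mem ha]

/-- At `q = -1`, the forest enumerator is given by any sequence that satisfies the even
convolution recurrence. -/
theorem forestSum_neg_one {α : Type*} [LinearOrder α] {R : Type*} [CommRing R] (t : R)
    (g : ℕ → R) (h0 : g 0 = 1)
    (hg : ∀ n, g (n + 1) = (t - 1) * g n +
      ∑ p ∈ Finset.HasAntidiagonal.antidiagonal n, ((n.choose p.1 : ℕ) : R) *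
        (if Even p.1 then g p.1 else 0) * g p.2) (V : Finset α) :
    forestSum (-1) t V = g V.card := by
  induction hn : V.card using Nat.strong_induction_on generalizing V with
  | _ N ih =>
    rcases V.eq_empty_or_nonempty with rfl | ⟨M, hM⟩
    · rw [forestSum_empty]
      simp only [Finset.card_empty] at hn
      rw [← hn, h0]
    · obtain ⟨n, rfl⟩ : ∃ n, N = n + 1 :=
        ⟨N - 1, by have := Finset.card_pos.2 ⟨M, hM⟩; omega⟩
      have hc : (V.erase M).card = n := by rw [Finset.card_erase_of_mem hM, hn]; rfl
      -- Contribution of a component with m vertices besides M. For m = 0 the single vertex is a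
      -- leaf, so t replaces g 0.
      let φ : ℕ → R := fun m => (if Even m then (if m = 0 then t else g m) else 0) * g (n - m)
      have e1 : forestSum (-1) t V = ∑ U ∈ (V.erase M).powerset, φ U.card := by
        rw [forestSum_eq_sum_component _ _ hM]
        symm
        refine Finset.sum_bij (fun U _ => insert M U) ?_ ?_ ?_ ?_
        · intro U hU
          rw [Finset.mem_powerset] at hU
          simp only [Finset.mem_filter, Finset.mem_powerset, Finset.mem_insert, true_or, and_true]
          exact Finset.insert_subset hM (hU.trans (Finset.erase_subset _ _))
        · intro U hU U' hU' h
          rw [Finset.mem_powerset] at hU hU'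
          have h1 : M ∉ U := fun h => by simpa using hU h
          have h2 : M ∉ U' := fun h => by simpa using hU' h
          rw [← Finset.erase_insert h1, h, Finset.erase_insert h2]
        · intro S hS
          rw [Finset.mem_filter, Finset.mem_powerset] at hS
          exact ⟨S.erase M, Finset.mem_powerset.2 (Finset.erase_subset_erase _ hS.1),
            Finset.insert_erase hS.2⟩
        · intro U hU
          rw [Finset.mem_powerset] at hU
          have h1 : M ∉ U := fun h => by simpa using hU h
          have hUc : U.card ≤ n := hc ▸ Finset.card_le_card hU
          have hS : (insert M U).card = U.card + 1 := Finset.card_insert_of_notMem h1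
          have hsub : insert M U ⊆ V :=
            Finset.insert_subset hM (hU.trans (Finset.erase_subset _ _))
          have hd : (V \ insert M U).card = n - U.card := by
            rw [Finset.card_sdiff_of_subset hsub, hS, hn]
            omega
          have e2 : ∀ r ∈ insert M U,
              (-1 : R) ^ ((insert M U).filter fun i => i < r).card *
              ((if (insert M U).erase r = ∅ then t else 1) *
              forestSum (-1) t ((insert M U).erase r)) * forestSum (-1) t (V \ insert M U) =
              (-1 : R) ^ ((insert M U).filter fun i => i < r).card *
              ((if U.card = 0 then t else g U.card) * g (n - U.card)) := by
            intro r hr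
            have he : ((insert M U).erase r).card = U.card := by
              rw [Finset.card_erase_of_mem hr, hS]; rfl
            have he' : (insert M U).erase r = ∅ ↔ U.card = 0 := by
              rw [← Finset.card_eq_zero, he]
            rw [ih _ (by omega) _ he, ih _ (by omega) _ hd]
            simp only [he']
            split_ifs with h
            · rw [h, h0]; ring
            · ring
          -- Only the sign depends on the root r; the alternating sum over ranks is 1 for odd |S|
          -- and 0 for even |S|.
          rw [Finset.sum_congr rfl e2, ← Finset.sum_mul,
            sum_card_filter_lt (fun k => (-1 : R) ^ k), neg_one_geom_sum, hS]
          simp only [Nat.even_add_one, φ]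
          split_ifs <;> simp
      rw [e1, Finset.sum_powerset_apply_card φ, hc, hg,
        Finset.Nat.sum_antidiagonal_eq_sum_range_succ
          (fun i j => ((n.choose i : ℕ) : R) * (if Even i then g i else 0) * g j),
        Finset.sum_range_succ', Finset.sum_range_succ']
      have e3 : ∀ k ∈ Finset.range n, n.choose (k + 1) • φ (k + 1) =
          ((n.choose (k + 1) : ℕ) : R) * (if Even (k + 1) then g (k + 1) else 0) *
            g (n - (k + 1)) := by
        intro k _
        simp only [φ, nsmul_eq_mul, Nat.succ_ne_zero, if_false]
        ring
      rw [Finset.sum_congr rfl e3]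
      simp [φ, h0]
      ring
/-! ### Trees and forest orders -/

section RootPath

variable {n : ℕ} {T : SimpleGraph (Fin (n + 1))}

theorem onRootPath_iff (hT : T.IsTree) {i j : Fin (n + 1)} {p : T.Walk i 0} (hp : p.IsPath) :
    OnRootPath T j i ↔ j ∈ p.support := by
  constructor
  · rintro ⟨q, hq, hj⟩
    rwa [(hT.existsUnique_path i 0).unique hp hq]
  · exact fun h => ⟨p, hp, h⟩

theorem exists_rootPath (hT : T.IsTree) (i : Fin (n + 1)) : ∃ p : T.Walk i 0, p.IsPath :=
  (hT.existsUnique_path i 0).exists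

theorem onRootPath_refl (hT : T.IsTree) (i : Fin (n + 1)) : OnRootPath T i i := by
  obtain ⟨p, hp⟩ := exists_rootPath hT i
  exact ⟨p, hp, p.start_mem_support⟩

theorem onRootPath_zero (hT : T.IsTree) (i : Fin (n + 1)) : OnRootPath T 0 i := by
  obtain ⟨p, hp⟩ := exists_rootPath hT i
  exact ⟨p, hp, p.end_mem_support⟩

theorem OnRootPath.eq_zero (hT : T.IsTree) {j : Fin (n + 1)} (h : OnRootPath T j 0) : j = 0 := by
  rw [onRootPath_iff hT (SimpleGraph.Walk.IsPath.nil)] at h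
  simpa using h

theorem OnRootPath.trans {i j k : Fin (n + 1)} (hT : T.IsTree)
    (hij : OnRootPath T j i) (hjk : OnRootPath T k j) : OnRootPath T k i := by
  classical
  obtain ⟨p, hp, hj⟩ := hij
  rw [onRootPath_iff hT (hp.dropUntil hj)] at hjk
  exact ⟨p, hp, p.support_dropUntil_subset_support hj hjk⟩

theorem OnRootPath.antisymm {i j : Fin (n + 1)} (hT : T.IsTree)
    (hij : OnRootPath T j i) (hji : OnRootPath T i j) : i = j := by
  classical
  by_contra hne
  obtain ⟨p, hp, hj⟩ := hij
  obtain ⟨q, hq, hi⟩ := hji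
  have h1 := SimpleGraph.Walk.length_dropUntil_lt_length hj (Ne.symm hne)
  have h2 := SimpleGraph.Walk.length_dropUntil_lt_length hi hne
  rw [(hT.existsUnique_path j 0).unique (hp.dropUntil hj) hq] at h1
  rw [(hT.existsUnique_path i 0).unique (hq.dropUntil hi) hp] at h2
  omega

/-- Follow the path until it meets j or k; the remainder is a root path through the other. The
endpoint stays a variable so that induction on the walk applies. -/
theorem onRootPath_or_of_mem_support (hT : T.IsTree) {i z : Fin (n + 1)} (p : T.Walk i z)
    (hz : z = 0) (hp : p.IsPath) {j k : Fin (n + 1)} (hj : j ∈ p.support) (hk : k ∈ p.support) :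
    OnRootPath T k j ∨ OnRootPath T j k := by
  induction p with
  | nil =>
    simp only [SimpleGraph.Walk.support_nil, List.mem_singleton] at hj hk
    subst hj hk
    exact Or.inl (onRootPath_refl hT _)
  | cons h p ih =>
    by_cases h1 : j ∈ p.support
    · by_cases h2 : k ∈ p.support
      · exact ih hz hp.of_cons h1 h2
      · rw [SimpleGraph.Walk.support_cons, List.mem_cons] at hk
        obtain rfl : k = _ := hk.resolve_right h2
        subst hz
        exact Or.inr ⟨_, hp, hj⟩
    · rw [SimpleGraph.Walk.support_cons, List.mem_cons] at hj
      obtain rfl : j = _ := hj.resolve_right h1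
      subst hz
      exact Or.inl ⟨_, hp, hk⟩

theorem OnRootPath.total {i j k : Fin (n + 1)} (hT : T.IsTree)
    (hj : OnRootPath T j i) (hk : OnRootPath T k i) : OnRootPath T k j ∨ OnRootPath T j k := by
  obtain ⟨p, hp, hj⟩ := hj
  rw [onRootPath_iff hT hp] at hk
  exact onRootPath_or_of_mem_support hT p rfl hp hj hk

theorem exists_isChild_of_mem_support {i z v : Fin (n + 1)} (p : T.Walk i z)
    (hz : z = 0) (hp : p.IsPath) (hv : v ∈ p.support) (hiv : i ≠ v) : ∃ w, IsChild T w v := by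
  induction p with
  | nil =>
    simp only [SimpleGraph.Walk.support_nil, List.mem_singleton] at hv
    exact absurd hv.symm hiv
  | @cons u x z h p ih =>
    by_cases hx : x = v
    · subst hx hz
      exact ⟨u, h.symm, _, hp, hv⟩
    · rw [SimpleGraph.Walk.support_cons, List.mem_cons] at hv
      exact ih hz hp.of_cons (hv.resolve_left (Ne.symm hiv)) hx

theorem OnRootPath.exists_isChild {i v : Fin (n + 1)} (h : OnRootPath T v i) (hiv : i ≠ v) :
    ∃ w, IsChild T w v := by
  obtain ⟨p, hp, hv⟩ := h
  exact exists_isChild_of_mem_support p rfl hp hv hiv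

/-- In a rooted tree, adjacency is the covering relation of the ancestor order. -/
theorem adj_iff_onRootPath (hT : T.IsTree) (u v : Fin (n + 1)) :
    T.Adj u v ↔
      (OnRootPath T u v ∧ u ≠ v ∧ ∀ w, OnRootPath T w v → w ≠ v → OnRootPath T w u) ∨
      (OnRootPath T v u ∧ v ≠ u ∧ ∀ w, OnRootPath T w u → w ≠ u → OnRootPath T w v) := by
  have key : ∀ u v, (OnRootPath T u v ∧ u ≠ v ∧
      ∀ w, OnRootPath T w v → w ≠ v → OnRootPath T w u) → T.Adj u v := by
    rintro u v ⟨⟨p, hp, hu⟩, huv, h⟩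
    cases p with
    | nil => simp at hu; exact absurd hu huv
    | @cons _ x _ hadj p =>
      rw [SimpleGraph.Walk.support_cons, List.mem_cons] at hu
      have hux : OnRootPath T u x := ⟨p, hp.of_cons, hu.resolve_left huv⟩
      have hxv : OnRootPath T x v := ⟨_, hp, by simp⟩
      have hxu := h x hxv hadj.ne'
      rw [hxu.antisymm hT hux]
      exact hadj.symm
  constructor
  · intro hadj
    obtain ⟨p, hp⟩ := exists_rootPath hT u
    -- If v lies on the root path of u, acyclicity makes it the second vertex; otherwise prefixing
    -- the edge gives the root path of v.
    by_cases hv : v ∈ p.support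
    · right
      have hvx := hT.isAcyclic.eq_snd_of_adj_start hp hadj hv
      refine ⟨⟨p, hp, hv⟩, hadj.ne', fun w hw hwu => ?_⟩
      rw [onRootPath_iff hT hp] at hw
      cases p with
      | nil => simp at hw; exact absurd hw hwu
      | @cons _ x _ h p =>
        rw [SimpleGraph.Walk.snd_cons] at hvx
        subst hvx
        rw [SimpleGraph.Walk.support_cons, List.mem_cons] at hw
        exact ⟨p, hp.of_cons, hw.resolve_left hwu⟩
    · left
      have hp' : (SimpleGraph.Walk.cons hadj.symm p).IsPath := hp.cons hv
      refine ⟨⟨_, hp', by simp⟩, hadj.ne, fun w hw hwv => ?_⟩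
      rw [onRootPath_iff hT hp', SimpleGraph.Walk.support_cons, List.mem_cons] at hw
      exact ⟨p, hp, hw.resolve_left hwv⟩
  · rintro (h | h)
    · exact key u v h
    · exact (key v u h).symm

end RootPath

open Classical in
/-- The proper ancestor relation between the non-root vertices of a tree rooted at `0`. -/
noncomputable def treeOrder {n : ℕ} (T : SimpleGraph (Fin (n + 1))) :
    Finset (Fin (n + 1) × Fin (n + 1)) :=
  Finset.univ.filter fun p => p.1 ≠ 0 ∧ p.2 ≠ 0 ∧ p.1 ≠ p.2 ∧ OnRootPath T p.2 p.1

theorem mem_treeOrder {n : ℕ} {T : SimpleGraph (Fin (n + 1))} {i j : Fin (n + 1)} :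
    (i, j) ∈ treeOrder T ↔ i ≠ 0 ∧ j ≠ 0 ∧ i ≠ j ∧ OnRootPath T j i := by
  simp [treeOrder]

theorem isForestOrder_treeOrder {n : ℕ} {T : SimpleGraph (Fin (n + 1))} (hT : T.IsTree) :
    IsForestOrder (Finset.univ.erase 0) (treeOrder T) := by
  constructor
  · intro i j h
    rw [mem_treeOrder] at h
    simp [h.1, h.2.1]
  · intro i h
    rw [mem_treeOrder] at h
    exact h.2.2.1 rfl
  · intro i j k hij hjk
    rw [mem_treeOrder] at *
    refine ⟨hij.1, hjk.2.1, ?_, hij.2.2.2.trans hT hjk.2.2.2⟩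
    rintro rfl
    exact hij.2.2.1 (hij.2.2.2.antisymm hT hjk.2.2.2)
  · intro i j k hij hik
    rw [mem_treeOrder] at *
    by_cases hjk : j = k
    · exact Or.inl hjk
    · have hkj : k ≠ j := Ne.symm hjk
      rcases hij.2.2.2.total hT hik.2.2.2 with h | h
      · rw [mem_treeOrder]; tauto
      · right; right; rw [mem_treeOrder]; tauto

theorem onRootPath_iff_treeOrder {n : ℕ} {T : SimpleGraph (Fin (n + 1))} (hT : T.IsTree)
    (i j : Fin (n + 1)) : OnRootPath T j i ↔ j = i ∨ j = 0 ∨ (i, j) ∈ treeOrder T := by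
  rw [mem_treeOrder]
  constructor
  · intro h
    by_cases hi : i = 0
    · subst hi
      exact Or.inl (h.eq_zero hT)
    · tauto
  · rintro (rfl | rfl | h)
    · exact onRootPath_refl hT _
    · exact onRootPath_zero hT _
    · exact h.2.2.2

/-- Adjacency is the covering relation of the ancestor order, so the order determines the tree. -/
theorem treeOrder_injective {n : ℕ} {T T' : SimpleGraph (Fin (n + 1))} (hT : T.IsTree)
    (hT' : T'.IsTree) (h : treeOrder T = treeOrder T') : T = T' := by
  ext u v
  rw [adj_iff_onRootPath hT, adj_iff_onRootPath hT']
  simp only [onRootPath_iff_treeOrder hT, onRootPath_iff_treeOrder hT', h]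

theorem treeInv_eq_forestInv {n : ℕ} (T : SimpleGraph (Fin (n + 1))) :
    treeInv T = forestInv (treeOrder T) := by
  classical
  unfold treeInv forestInv treeOrder
  rw [Finset.filter_filter]
  congr 1
  ext ⟨i, j⟩
  simp only [Finset.mem_filter, Finset.mem_univ, true_and]
  constructor
  · rintro ⟨h1, h2, h3⟩
    exact ⟨⟨h1.ne', (h1.trans h2).ne', h2.ne, h3⟩, h2⟩
  · rintro ⟨⟨h1, -, -, h3⟩, h2⟩
    exact ⟨Fin.pos_of_ne_zero h1, h2, h3⟩

/-- For n ≥ 1 the root has a child, so omitting it from the vertex set loses no leaf. -/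
theorem treeLev_eq_forestLev {n : ℕ} (hn : 1 ≤ n) {T : SimpleGraph (Fin (n + 1))}
    (hT : T.IsTree) :
    treeLev T = forestLev (Finset.univ.erase 0) (treeOrder T) := by
  classical
  unfold treeLev forestLev
  congr 1
  ext v
  simp only [Finset.mem_filter, Finset.mem_univ, true_and, Finset.mem_erase, and_true]
  constructor
  · intro h
    refine ⟨?_, fun u hu => ?_⟩
    · rintro rfl
      obtain ⟨w, hw⟩ := (onRootPath_zero hT (⟨1, by omega⟩ : Fin (n + 1))).exists_isChild
        (by intro h; simpa using congrArg Fin.val h)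
      exact h w hw
    · rw [mem_treeOrder] at hu
      obtain ⟨w, hw⟩ := hu.2.2.2.exists_isChild hu.2.2.1
      exact h w hw
  · rintro ⟨hv, h⟩ w ⟨hadj, hw⟩
    refine h w (mem_treeOrder.2 ⟨?_, hv, hadj.ne', hw⟩)
    rintro rfl
    exact hv (hw.eq_zero hT)

/-- The witness is the lowest proper ancestor of v, or 0 if there is none. The equivalence is shaped
for induction: it says that the root path of v, after v, is that of its parent. -/
theorem IsForestOrder.exists_parent {n : ℕ} {A : Finset (Fin (n + 1) × Fin (n + 1))}
    (hA : IsForestOrder (Finset.univ.erase 0) A) (v : Fin (n + 1)) :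
    ∃ u, ∀ w, (w = 0 ∨ (v, w) ∈ A) ↔ (w = u ∨ w = 0 ∨ (u, w) ∈ A) := by
  classical
  have h0 : ∀ w, (0, w) ∉ A := fun w hw => by simpa using (hA.mem _ _ hw).1
  by_cases h : ∃ w, (v, w) ∈ A
  · obtain ⟨w, hw⟩ := h
    obtain ⟨u, hu, hmin⟩ := Finset.exists_min_image (Finset.univ.filter fun w => (v, w) ∈ A)
      (fun w => (forestDesc (Finset.univ.erase 0) A w).card) ⟨w, by simp [hw]⟩
    simp only [Finset.mem_filter, Finset.mem_univ, true_and] at hu hmin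
    refine ⟨u, fun w => ?_⟩
    constructor
    · rintro (h | h)
      · exact Or.inr (Or.inl h)
      · rcases hA.chain _ _ _ hu h with h1 | h1 | h1
        · exact Or.inl h1.symm
        · exact Or.inr (Or.inr h1)
        · have := hA.card_desc_lt h1
          have := hmin w h
          omega
    · rintro (rfl | h | h)
      · exact Or.inr hu
      · exact Or.inl h
      · exact Or.inr (hA.trans _ _ _ hu h)
  · push Not at h
    refine ⟨0, fun w => ?_⟩
    have := h w
    have := h0 w
    tauto

theorem exists_isTree_treeOrder_eq {n : ℕ} {A : Finset (Fin (n + 1) × Fin (n + 1))}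
    (hA : IsForestOrder (Finset.univ.erase 0) A) :
    ∃ T : SimpleGraph (Fin (n + 1)), T.IsTree ∧ treeOrder T = A := by
  classical
  choose par hpar using hA.exists_parent
  have hmem : ∀ i j, (i, j) ∈ A → i ≠ 0 ∧ j ≠ 0 := fun i j h => by
    simpa using hA.mem _ _ h
  have hparA : ∀ v, par v ≠ 0 → (v, par v) ∈ A := fun v hv =>
    ((hpar v (par v)).2 (Or.inl rfl)).resolve_left hv
  have hparne : ∀ v, v ≠ 0 → par v ≠ v := fun v hv h =>
    hA.irrefl v (by simpa [h] using hparA v (h.symm ▸ hv))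
  let T : SimpleGraph (Fin (n + 1)) := SimpleGraph.fromRel fun v u => v ≠ 0 ∧ par v = u
  have hadj : ∀ v, v ≠ 0 → T.Adj v (par v) := fun v hv => by
    rw [SimpleGraph.fromRel_adj]
    exact ⟨(hparne v hv).symm, Or.inl ⟨hv, rfl⟩⟩
  -- The measure is the depth of v. The added 1 makes it drop also from a vertex without ancestors
  -- in A to the root.
  have hwalk : ∀ (m : ℕ) (v : Fin (n + 1)),
      (if v = 0 then 0 else (Finset.univ.filter fun w => (v, w) ∈ A).card + 1) = m →
      ∃ p : T.Walk v 0, p.IsPath ∧ ∀ w, w ∈ p.support ↔ w = v ∨ w = 0 ∨ (v, w) ∈ A := by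
    intro m
    induction m using Nat.strong_induction_on with
    | _ m ih =>
      intro v hv
      by_cases h0 : v = 0
      · subst h0
        refine ⟨SimpleGraph.Walk.nil, SimpleGraph.Walk.IsPath.nil, fun w => ?_⟩
        have := hmem 0 w
        simp only [SimpleGraph.Walk.support_nil, List.mem_singleton]
        tauto
      · rw [if_neg h0] at hv
        obtain ⟨p, hp, hsupp⟩ := ih _ (by
          rw [← hv]
          split_ifs with h1
          · omega
          · apply Nat.succ_lt_succ
            apply Finset.card_lt_card
            rw [Finset.ssubset_iff_of_subset]
            · exact ⟨par v, by simp [hparA v h1], by simp [hA.irrefl]⟩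
            · intro w hw
              simp only [Finset.mem_filter, Finset.mem_univ, true_and] at hw ⊢
              exact hA.trans _ _ _ (hparA v h1) hw) (par v) rfl
        refine ⟨SimpleGraph.Walk.cons (hadj v h0) p, hp.cons ?_, fun w => ?_⟩
        · rw [hsupp, ← hpar]
          rintro (h | h)
          · exact h0 h
          · exact hA.irrefl _ h
        · rw [SimpleGraph.Walk.support_cons, List.mem_cons, hsupp, ← hpar]
  have hconn : T.Connected := by
    rw [SimpleGraph.connected_iff_exists_forall_reachable]
    exact ⟨0, fun w => by
      obtain ⟨p, -⟩ := hwalk _ w rfl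
      exact p.reachable.symm⟩
  -- Every edge joins some nonzero v to its parent, so there are at most n edges; connectedness
  -- gives the reverse bound.
  have hcard : Nat.card T.edgeSet + 1 = Nat.card (Fin (n + 1)) := by
    apply le_antisymm _ hconn.card_vert_le_card_edgeSet_add_one
    rw [Nat.card_eq_fintype_card, Nat.card_eq_fintype_card, Fintype.card_fin, ← SimpleGraph.edgeFinset_card]
    have hsub : T.edgeFinset ⊆ (Finset.univ.erase 0).image fun v => s(v, par v) := by
      intro e
      induction e using Sym2.ind with
      | _ u v =>
        rw [SimpleGraph.mem_edgeFinset, SimpleGraph.mem_edgeSet, SimpleGraph.fromRel_adj]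
        rintro ⟨-, ⟨h1, rfl⟩ | ⟨h1, rfl⟩⟩
        · exact Finset.mem_image.2 ⟨u, by simp [h1], rfl⟩
        · exact Finset.mem_image.2 ⟨v, by simp [h1], Sym2.eq_swap⟩
    have := (Finset.card_le_card hsub).trans Finset.card_image_le
    rw [Finset.card_erase_of_mem (Finset.mem_univ _), Finset.card_univ, Fintype.card_fin] at this
    omega
  have hT : T.IsTree := SimpleGraph.isTree_iff_connected_and_card.2 ⟨hconn, hcard⟩
  refine ⟨T, hT, ?_⟩
  ext ⟨i, j⟩
  obtain ⟨p, hp, hsupp⟩ := hwalk _ i rfl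
  rw [mem_treeOrder, onRootPath_iff hT hp, hsupp]
  have h1 := hmem i j
  have h2 : i = j → (i, j) ∉ A := by rintro rfl; exact hA.irrefl i
  have h3 : j = i ↔ i = j := eq_comm
  tauto

/-- The tree enumerator is a forest enumerator. -/
theorem mul_treeEnumerator {R : Type*} [CommRing R] {n : ℕ} (hn : 1 ≤ n) (q t : R) :
    t * treeEnumerator n q t = forestSum q t (Finset.univ.erase (0 : Fin (n + 1))) := by
  classical
  have hV : (Finset.univ.erase (0 : Fin (n + 1))).Nonempty :=
    ⟨⟨1, by omega⟩, Finset.mem_erase.2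
      ⟨fun h => by simpa using congrArg Fin.val h, Finset.mem_univ _⟩⟩
  rw [treeEnumerator, forestSum, Finset.mul_sum]
  refine Finset.sum_bij (fun T _ => treeOrder T) ?_ ?_ ?_ ?_
  · intro T hT
    rw [mem_forestOrders]
    exact isForestOrder_treeOrder (Finset.mem_filter.1 hT).2
  · intro T hT T' hT' h
    exact treeOrder_injective (Finset.mem_filter.1 hT).2 (Finset.mem_filter.1 hT').2 h
  · intro A hA
    rw [mem_forestOrders] at hA
    obtain ⟨T, hT, h⟩ := exists_isTree_treeOrder_eq hA
    exact ⟨T, Finset.mem_filter.2 ⟨Finset.mem_univ _, hT⟩, h⟩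
  · intro T hT
    have hT := (Finset.mem_filter.1 hT).2
    rw [← treeInv_eq_forestInv, treeLev_eq_forestLev hn hT]
    -- A leaf exists, so the exponent lev - 1 is not truncated.
    obtain ⟨k, hk⟩ := Nat.exists_eq_add_of_le' ((isForestOrder_treeOrder hT).one_le_lev hV)
    rw [hk, Nat.add_sub_cancel, pow_succ]
    ring

/-! ### The identity over ℚ and its transfer to arbitrary rings -/

open Polynomial in
theorem forestSum_neg_one_eq_X_mul_simsunPoly (n : ℕ) :
    forestSum (-1) (X : ℚ[X]) (Finset.univ.erase (0 : Fin (n + 2))) =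
      X * simsunPoly n (X : ℚ[X]) := by
  let g : ℕ → ℚ[X] := fun m => match m with
    | 0 => 1
    | m + 1 => X * simsunPoly m (X : ℚ[X])
  have h := forestSum_neg_one (X : ℚ[X]) g rfl
    (convolution_of_derivative_recurrence g rfl (by simp [g, simsunPoly_zero]) fun m => by
      simp only [g, simsunPoly_succ, derivative_mul, derivative_X]
      ring) (Finset.univ.erase (0 : Fin (n + 2)))
  have hc : (Finset.univ.erase (0 : Fin (n + 2))).card = n + 1 := by simp
  rw [h, hc]

theorem map_treeEnumerator {R S : Type*} [CommRing R] [CommRing S] (φ : R →+* S) (n : ℕ)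
    (t : R) : φ (treeEnumerator n (-1) t) = treeEnumerator n (-1) (φ t) := by
  simp [treeEnumerator]

theorem map_simsunPoly {R S : Type*} [CommRing R] [CommRing S] (φ : R →+* S) (n : ℕ)
    (t : R) : φ (simsunPoly n t) = simsunPoly n (φ t) := by
  simp [simsunPoly]

theorem theorem3p5 {R : Type*} [CommRing R] (n : ℕ) (hn : 1 ≤ n) (t : R) :
    treeEnumerator n (-1) t =
      ∑ w ∈ simsunPerms (n - 1), t ^ (n - 1 - permDes w) := by
  obtain ⟨m, rfl⟩ := Nat.exists_eq_add_of_le' hn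
  rw [Nat.add_sub_cancel]
  change _ = simsunPoly m t
  -- The factor t can be cancelled only because t is the indeterminate here; general t is reached by
  -- specialization.
  have hQ : treeEnumerator (m + 1) (-1) (Polynomial.X : Polynomial ℚ) =
      simsunPoly m Polynomial.X :=
    mul_left_cancel₀ Polynomial.X_ne_zero
      ((mul_treeEnumerator hn _ _).trans (forestSum_neg_one_eq_X_mul_simsunPoly m))
  have hZ : treeEnumerator (m + 1) (-1) (Polynomial.X : Polynomial ℤ) =
      simsunPoly m Polynomial.X := by
    apply Polynomial.map_injective (Int.castRingHom ℚ) Int.cast_injective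
    have h1 := map_treeEnumerator (Polynomial.mapRingHom (Int.castRingHom ℚ)) (m + 1)
      Polynomial.X
    have h2 := map_simsunPoly (Polynomial.mapRingHom (Int.castRingHom ℚ)) m Polynomial.X
    rw [Polynomial.coe_mapRingHom, Polynomial.map_X] at h1 h2
    rw [h1, h2, hQ]
  have h1 := map_treeEnumerator (Polynomial.eval₂RingHom (Int.castRingHom R) t) (m + 1)
    Polynomial.X
  have h2 := map_simsunPoly (Polynomial.eval₂RingHom (Int.castRingHom R) t) m Polynomial.X
  rw [Polynomial.coe_eval₂RingHom, Polynomial.eval₂_X] at h1 h2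
  rw [← h1, ← h2, hZ]
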